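/- **Setting.** Let $N\ge 1$ and consider the $N\times N$ square lattice on the torus, with vertex set $\mathbb Z_N\times\mathbb Z_N$ and edge set $\Lambda$; horizontal edges point to the left and vertical edges point downward. A star $s$ is a vertex; $ds=d_+s\cup d_-s$ is the set of its incident edges, where $d_+s$ consists of those pointing away from the vertex and $d_-s$ of those pointing to it. For a plaquette $p$ (a unit face), $\partial p=\partial_+p\cup\partial_-p$ is the set of its boundary edges, where $\partial_+p$ consists of those oriented counterclockwise along the boundary and $\partial_-p$ of those oriented clockwise. For $R\subseteq\Lambda$ let $\mathcal S_R$ be the set of stars $s$ with $ds\cap R\ne\emptyset$ and $\mathcal P_R$ the set of plaquettes $p$ with $\partial p\cap R\neq\emptyset$. The set $R$ is *star-connected* if any two edges of $R$ are joined by a path of edges of $R$ in which any two consecutive edges lie in a common set $ds$; it is *plaquette-connected* if the same holds with the sets $\partial p$. Let $G$ be a finite Abelian group with character group $\hat G=\mathrm{Hom}(G,U(1))$, let $\mathcal H_e=\ell^2(G)$ with orthonormal basis $\{|g\rangle\}_{g\in G}$ for $e\in\Lambda$, and let $\mathcal H_V=\bigotimes_{e\in V}\mathcal H_e$ for $V\subseteq\Lambda$.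 Put $L^g=\sum_h|gh\rangle\langle h|$ and $M^\chi=\sum_g\chi(g)|g\rangle\langle g|$. For $g\in G$, $\chi\in\hat G$ let $A_s(g)$ act as $L^g$ on the edges of $d_+s$ and as $L^{g^{-1}}$ on those of $d_-s$, let $B_p(\chi)$ act as $M^\chi$ on the edges of $\partial_+p$ and as $M^{\overline\chi}$ on those of $\partial_-p$ (both act as the identity on all other edges), and set $$A_s=\frac1{|G|}\sum_{g\in G}A_s(g),\quad B_p=\frac1{|\hat G|}\sum_{\chi\in\hat G}B_p(\chi),\quad A_s(\chi)=\frac1{|G|}\sum_{g\in G}\chi(g)A_s(g),\quad B_p(g)=\frac1{|\hat G|}\sum_{\chi\in\hat G}\chi(g)B_p(\chi).$$ (If $N=1$, an edge lies in both $d_+s$ and $d_-s$, and in both $\partial_+p$ and $\partial_-p$, and the product of the two factors acts on it.) The Hamiltonian is $H=-\sum_sA_s-\sum_pB_p$, summed over all stars and plaquettes, with spectral projections $P_\lambda$. Let $\Omega$ be the set of differences of eigenvalues of $H$, and put $Q(\omega)=\sum_{\lambda-\lambda'=\omega}P_\lambda QP_{\lambda'}$ for $Q\in\mathcal B(\mathcal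 H_\Lambda)$ and $\omega\in\Omega$. Let $\beta\in\mathbb R$ and let $I$ be a finite index set. For every $e\in\Lambda$ let $\{S_{e,i}\}_{i\in I}\subset\mathcal B(\mathcal H_e)$ be a set that is closed under the adjoint and whose commutant in $\mathcal B(\mathcal H_e)$ consists of the scalars only. Let $h_{e,i}(\omega)>0$ ($e\in\Lambda$, $i\in I$, $\omega\in\Omega$) satisfy $h_{e,i}(-\omega)=h_{e,i}(\omega)e^{-\beta\omega}$. The Davies Lindbladian on $R\subseteq\Lambda$ is the linear map on $\mathcal B(\mathcal H_\Lambda)$ $$\mathcal L_R(O)=\sum_{e\in R}\sum_{i\in I}\sum_{\omega\in\Omega}h_{e,i}(\omega)\Bigl(S_{e,i}(\omega)^\dagger\,O\,S_{e,i}(\omega)-\tfrac12\bigl\{S_{e,i}(\omega)^\dagger S_{e,i}(\omega),O\bigr\}\Bigr).$$ **Theorem.** Let $R\subseteq\Lambda$ be star-connected and plaquette-connected with $|R|\ge2$. Then $$\ker(\mathcal L_R)=\bigl(\mathbb 1_R\otimes\mathcal B(\mathcal H_{\Lambda\setminus R})\bigr)\cap\{A_s,B_p\}'_{s\in\mathcal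 S_R,\,p\in\mathcal P_R},$$ and also $$\ker(\mathcal L_R)=\bigl(\mathbb 1_R\otimes\mathcal B(\mathcal H_{\Lambda\setminus R})\bigr)\cap\{A_s(\chi),B_p(g)\}'_{s\in\mathcal S_R,\,p\in\mathcal P_R,\,\chi\in\hat G,\,g\in G},$$ where $'$ denotes the commutant in $\mathcal B(\mathcal H_\Lambda)$. -/

import Mathlib

open scoped Matrix

noncomputable section

namespace QuantumDouble

/-! ## The lattice -/

/-- Vertices of the `N × N` square lattice on the torus. A star is labelled by its vertex. -/
abbrev Vertex (N : ℕ) : Type := ZMod N × ZMod N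

/-- Plaquettes of the `N × N` torus, labelled by their upper right corner. -/
abbrev Plaquette (N : ℕ) : Type := ZMod N × ZMod N

/-- Edges of the `N × N` torus. `Sum.inl (x, y)` is the horizontal edge pointing left, from `(x, y)`
to `(x - 1, y)`; `Sum.inr (x, y)` is the vertical edge pointing down, from `(x, y)` to
`(x, y - 1)`. -/
abbrev Edge (N : ℕ) : Type := (ZMod N × ZMod N) ⊕ (ZMod N × ZMod N)

variable {N : ℕ}

/-- The edges of a star that point away from its vertex (the left and the lower edge). -/
def starPos (s : Vertex N) : Finset (Edge N) :=
  {Sum.inl (s.1, s.2), Sum.inr (s.1, s.2)}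

/-- The edges of a star that point to its vertex (the right and the upper edge). -/
def starNeg (s : Vertex N) : Finset (Edge N) :=
  {Sum.inl (s.1 + 1, s.2), Sum.inr (s.1, s.2 + 1)}

/-- The edges of a star. -/
def starEdges (s : Vertex N) : Finset (Edge N) := starPos s ∪ starNeg s

/-- The edges of a plaquette that run counterclockwise along its boundary
(the upper and the left edge). -/
def plaqPos (p : Plaquette N) : Finset (Edge N) :=
  {Sum.inl (p.1, p.2), Sum.inr (p.1 - 1, p.2)}

/-- The edges of a plaquette that run clockwise along its boundary
(the lower and the right edge). -/
def plaqNeg (p : Plaquette N) : Finset (Edge N) :=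
  {Sum.inl (p.1, p.2 - 1), Sum.inr (p.1, p.2)}

/-- The edges of the boundary of a plaquette. -/
def plaqEdges (p : Plaquette N) : Finset (Edge N) := plaqPos p ∪ plaqNeg p

/-- Any two edges of `R` are joined by a path of edges of `R` in which consecutive edges belong to
a common star. -/
def StarConnected (R : Finset (Edge N)) : Prop :=
  ∀ e ∈ R, ∀ e' ∈ R, Relation.ReflTransGen
    (fun a b : Edge N => a ∈ R ∧ b ∈ R ∧ ∃ s : Vertex N, a ∈ starEdges s ∧ b ∈ starEdges s) e e'

/-- Any two edges of `R` are joined by a path of edges of `R` in which consecutive edges belong to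
a common plaquette. -/
def PlaquetteConnected (R : Finset (Edge N)) : Prop :=
  ∀ e ∈ R, ∀ e' ∈ R, Relation.ReflTransGen
    (fun a b : Edge N => a ∈ R ∧ b ∈ R ∧ ∃ p : Plaquette N, a ∈ plaqEdges p ∧ b ∈ plaqEdges p) e e'

variable [NeZero N]

/-- The stars that meet `R`. -/
def starsMeeting (R : Finset (Edge N)) : Finset (Vertex N) :=
  Finset.univ.filter fun s => (starEdges s ∩ R).Nonempty

/-- The plaquettes that meet `R`. -/
def plaqsMeeting (R : Finset (Edge N)) : Finset (Plaquette N) :=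
  Finset.univ.filter fun p => (plaqEdges p ∩ R).Nonempty

/-! ## Operators

The Hilbert space `⨂ₑ ℓ²(G)` has the orthonormal basis of all configurations `Edge N → G`, and its
operators are the matrices with respect to that basis. -/

variable {G : Type*}

variable (N G) in
/-- Operators on the tensor product over all edges of the Hilbert spaces `ℓ²(G)`. -/
abbrev Op : Type _ := Matrix (Edge N → G) (Edge N → G) ℂ

/-- The tensor product of the operators `Q e` over all edges `e`. -/
def tensorOp (Q : Edge N → Matrix G G ℂ) : Op N G :=
  Matrix.of fun x y => ∏ e, Q e (x e) (y e)

section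

variable [DecidableEq G]

/-- The operator `Q` acting on the edge `e`, tensored with the identity on all other edges. -/
def siteOp (e : Edge N) (Q : Matrix G G ℂ) : Op N G :=
  tensorOp (Function.update (fun _ => (1 : Matrix G G ℂ)) e Q)

/-- `1_R ⊗ Q` for an operator `Q` on the complement of `R`. -/
def oneTensor (R : Finset (Edge N))
    (Q : Matrix ({e : Edge N // e ∉ R} → G) ({e : Edge N // e ∉ R} → G) ℂ) : Op N G :=
  Matrix.of fun x y => if ∀ e ∈ R, x e = y e then Q (fun e => x e) (fun e => y e) else 0

/-- The left regular representation `∑ h, |g h⟩⟨h|`. -/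
def leftReg [Group G] (g : G) : Matrix G G ℂ :=
  Matrix.of fun a b => if a = g * b then 1 else 0

/-- The diagonal operator `∑ g, χ g |g⟩⟨g|`. -/
def charOp [Group G] (χ : G →* Circle) : Matrix G G ℂ :=
  Matrix.diagonal fun g => (χ g : ℂ)

end

/-- A finite commutative group has finitely many characters. -/
instance finite_characters [CommGroup G] [Finite G] : Finite (G →* Circle) :=
  Finite.of_injective
    (fun χ : G →* Circle =>
      ({ toFun := fun a => (χ a.toMul : ℂ)
         map_zero_eq_one' := by simp
         map_add_eq_mul' := fun a b => by simp } : AddChar (Additive G) ℂ))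
    fun χ ψ hχ => by
      ext g
      exact DFunLike.congr_fun hχ (Additive.ofMul g)

instance fintype_characters [CommGroup G] [Finite G] : Fintype (G →* Circle) :=
  Fintype.ofFinite _

variable [CommGroup G] [Fintype G] [DecidableEq G]

/-- `A_s(g)`: apply `L^g` on the edges pointing away from the vertex, `L^{g⁻¹}` on the edges
pointing to it. -/
def starUnitary (s : Vertex N) (g : G) : Op N G :=
  tensorOp fun e =>
    (if e ∈ starPos s then leftReg g else 1) * (if e ∈ starNeg s then leftReg g⁻¹ else 1)

/-- `B_p(χ)`: apply `M^χ` on the counterclockwise edges, `M^{χ⁻¹}` on the clockwise edges. -/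
def plaqUnitary (p : Plaquette N) (χ : G →* Circle) : Op N G :=
  tensorOp fun e =>
    (if e ∈ plaqPos p then charOp χ else 1) * (if e ∈ plaqNeg p then charOp χ⁻¹ else 1)

variable (G) in
/-- The star operator `A_s`. -/
def starOp (s : Vertex N) : Op N G :=
  (1 / (Fintype.card G : ℂ)) • ∑ g : G, starUnitary s g

variable (G) in
/-- The plaquette operator `B_p`. -/
def plaqOp (p : Plaquette N) : Op N G :=
  (1 / (Fintype.card (G →* Circle) : ℂ)) • ∑ χ : G →* Circle, plaqUnitary p χ

/-- The generalized star operator `A_s(χ)`. -/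
def starProj (s : Vertex N) (χ : G →* Circle) : Op N G :=
  (1 / (Fintype.card G : ℂ)) • ∑ g : G, (χ g : ℂ) • starUnitary s g

/-- The generalized plaquette operator `B_p(g)`. -/
def plaqProj (p : Plaquette N) (g : G) : Op N G :=
  (1 / (Fintype.card (G →* Circle) : ℂ)) • ∑ χ : G →* Circle, (χ g : ℂ) • plaqUnitary p χ

variable (G) in
/-- The quantum double Hamiltonian `H_V`. -/
def hamiltonian (V : Finset (Edge N)) : Op N G :=
  -(∑ s ∈ starsMeeting V, starOp G s) - ∑ p ∈ plaqsMeeting V, plaqOp G p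

/-! ## The Davies generator -/

section Spectral

variable {n : Type*} [Fintype n] [DecidableEq n]

/-- The finite set of real eigenvalues of a matrix (all of them, if it is Hermitian). -/
def eigs (H : Matrix n n ℂ) : Finset ℝ := H.finite_real_spectrum.toFinset

/-- The orthogonal projection onto the eigenspace of `H` at `l`. -/
def spectralProj (H : Matrix n n ℂ) (l : ℝ) : Matrix n n ℂ :=
  (Matrix.toEuclideanCLM (n := n) (𝕜 := ℂ)).symm
    (Module.End.eigenspace
      ((Matrix.toEuclideanCLM (n := n) (𝕜 := ℂ) H : EuclideanSpace ℂ n →L[ℂ] EuclideanSpace ℂ n) :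
        EuclideanSpace ℂ n →ₗ[ℂ] EuclideanSpace ℂ n) (l : ℂ)).starProjection

/-- The Bohr frequencies of `H`: all differences of eigenvalues. -/
def bohr (H : Matrix n n ℂ) : Finset ℝ :=
  (eigs H ×ˢ eigs H).image fun l => l.1 - l.2

/-- The component `Q(ω) = ∑_{l - l' = ω} P_l Q P_{l'}` of `Q` at frequency `ω`. -/
def fourier (H Q : Matrix n n ℂ) (ω : ℝ) : Matrix n n ℂ :=
  ∑ l ∈ (eigs H ×ˢ eigs H).filter (fun l => l.1 - l.2 = ω),
    spectralProj H l.1 * Q * spectralProj H l.2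

/-- The map `O ↦ V† O V - (V† V O + O V† V) / 2` of a jump operator `V`. -/
def jumpTerm (V : Matrix n n ℂ) : Matrix n n ℂ →ₗ[ℂ] Matrix n n ℂ where
  toFun O := Vᴴ * O * V - (1 / 2 : ℂ) • (Vᴴ * V * O + O * (Vᴴ * V))
  map_add' O O' := by
    simp only [mul_add, add_mul, smul_add]
    abel
  map_smul' c O := by
    simp only [Matrix.mul_smul, Matrix.smul_mul, RingHom.id_apply, smul_sub, smul_add,
      smul_comm c (1 / 2 : ℂ)]

end Spectral

/-- The Davies generator on `V` in the Heisenberg picture, for the full Hamiltonian of the torus,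
bare jump operators `S e i` and jump rates `h e i ω`. -/
def davies {I : Type*} [Fintype I] (S : Edge N → I → Matrix G G ℂ) (h : Edge N → I → ℝ → ℝ)
    (V : Finset (Edge N)) : Op N G →ₗ[ℂ] Op N G :=
  ∑ e ∈ V, ∑ i : I, ∑ ω ∈ bohr (hamiltonian G (Finset.univ : Finset (Edge N))),
    (h e i ω : ℂ) •
      jumpTerm (fourier (hamiltonian G (Finset.univ : Finset (Edge N))) (siteOp e (S e i)) ω)

end QuantumDouble

end

/-! The generator has no Hamiltonian part, its rates are positive and its jump operators S(ω) form a
family closed under the adjoint. Hence its kernel is the commutant of that family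
(`sum_jumpTerm_eq_zero_iff`): for Hermitian O, written in an eigenbasis, the diagonal of the kernel
equation is a classical rate equation, and reading it from the largest eigenvalue downwards rules
out every transition between distinct eigenvalues.

Let O commute with all S(ω). Then O commutes with S = ∑ S(ω) and with [H, S] = ∑ ω S(ω). Triviality
of the commutant of the S on an edge makes O act as the identity on R, and by the Jacobi identity
[O, H] commutes with all operators on each edge of R as well. Now average over conjugation by all
M^χ on an edge e of R. This commutes with [O, ·], fixes [O, H], the plaquette terms and the stars
away from e, and turns the two stars at e into scalars. So O commutes with the sum of those two
stars. Connectedness in both senses and |R| ≥ 2 give an edge of R in exactly one of them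
(`exists_separating_edge`), and averaging there splits the sum (`commute_of_twirl`). Plaquettes are
treated dually, averaging over L^g.

Conversely, let O act as the identity on R and commute with the stars and plaquettes at e. The
remaining terms of H commute with operators on e, so iterated commutators of H with S never leave
the commutant of O; the S(ω) are the eigencomponents of S under [H, ·] and stay there too
(`commute_fourier_siteOp`).

The second formula follows because A_s(χ) and B_p(g) are conjugates of A_s and B_p by a unitary on
an edge of R. For N = 1 every A_s and B_p is the identity and is handled apart. -/

namespace QuantumDouble

/-! ### Kernels of self-adjoint families of jump operators -/

section Lindblad

variable {n : Type*} [Fintype n] [DecidableEq n]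

lemma jumpTerm_apply (V O : Matrix n n ℂ) :
    jumpTerm V O = Vᴴ * O * V - (1 / 2 : ℂ) • (Vᴴ * V * O + O * (Vᴴ * V)) := rfl

lemma jumpTerm_conjTranspose (V O : Matrix n n ℂ) :
    jumpTerm V Oᴴ = (jumpTerm V O)ᴴ := by
  simp only [jumpTerm_apply, Matrix.conjTranspose_sub, Matrix.conjTranspose_smul,
    Matrix.conjTranspose_add, Matrix.conjTranspose_mul, Matrix.conjTranspose_conjTranspose]
  rw [show star (1 / 2 : ℂ) = 1 / 2 by simp]
  rw [add_comm (Oᴴ * _), Matrix.mul_assoc Vᴴ Oᴴ V]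

lemma jumpTerm_conj (U V O : Matrix n n ℂ) (hU : U * Uᴴ = 1) :
    jumpTerm (Uᴴ * V * U) (Uᴴ * O * U) = Uᴴ * jumpTerm V O * U := by
  have key : ∀ X : Matrix n n ℂ, U * (Uᴴ * X) = X := fun X => by
    rw [← Matrix.mul_assoc, hU, Matrix.one_mul]
  simp only [jumpTerm_apply, Matrix.conjTranspose_mul, Matrix.conjTranspose_conjTranspose,
    Matrix.mul_sub, Matrix.sub_mul, Matrix.mul_smul, Matrix.smul_mul, Matrix.mul_add,
    Matrix.add_mul, Matrix.mul_assoc, key]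

lemma jumpTerm_eq_zero_of_commute {V O : Matrix n n ℂ} (h : Commute V O) (h' : Commute Vᴴ O) :
    jumpTerm V O = 0 := by
  have h2 : Vᴴ * V * O = O * (Vᴴ * V) := (h'.mul_left h).eq
  rw [jumpTerm_apply, h'.eq, Matrix.mul_assoc, ← h2, h2, ← two_smul ℂ (O * (Vᴴ * V)), smul_smul]
  norm_num

/-- On the diagonal the two halves of the anticommutator agree, so gain minus loss is a classical
Markov generator with rates |V i j|². -/
lemma jumpTerm_diagonal_apply (V : Matrix n n ℂ) (l : n → ℝ) (j : n) :
    jumpTerm V (Matrix.diagonal fun i => (l i : ℂ)) j j =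
      ((∑ i, Complex.normSq (V i j) * (l i - l j) : ℝ) : ℂ) := by
  rw [jumpTerm_apply, Matrix.sub_apply, Matrix.smul_apply, Matrix.add_apply, Matrix.mul_diagonal,
    Matrix.diagonal_mul, Matrix.mul_apply, Matrix.mul_apply, Complex.ofReal_sum, smul_eq_mul,
    Finset.sum_mul, Finset.mul_sum, ← Finset.sum_add_distrib, Finset.mul_sum,
    ← Finset.sum_sub_distrib]
  refine Finset.sum_congr rfl fun i _ => ?_
  rw [Complex.ofReal_mul, Complex.normSq_eq_conj_mul_self, Complex.ofReal_sub, Matrix.mul_diagonal,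
    Matrix.conjTranspose_apply, Complex.star_def]
  ring

variable {κ : Type*} {s : Finset κ} {c : κ → ℝ} {V : κ → Matrix n n ℂ}

/-- If the jump operators are closed under the adjoint, a diagonal matrix in the kernel of the
Lindbladian has eigenspaces that reduce all of them. -/
lemma eq_zero_of_sum_jumpTerm_diagonal (hc : ∀ k ∈ s, 0 < c k)
    (hV : ∀ k ∈ s, ∃ k' ∈ s, (V k)ᴴ = V k') (l : n → ℝ)
    (h0 : ∑ k ∈ s, (c k : ℂ) • jumpTerm (V k) (Matrix.diagonal fun i => (l i : ℂ)) = 0) (j : n) :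
    ∀ k ∈ s, ∀ i, l i ≠ l j → V k i j = 0 := by
  -- The induction starts at the largest values of `l`: the predecessors of `j` are the indices with
  -- a strictly larger value.
  have wf : WellFounded fun a b : n => l b < l a :=
    have : IsTrans n fun a b => l b < l a := ⟨fun _ _ _ h1 h2 => h2.trans h1⟩
    have : Std.Irrefl fun a b : n => l b < l a := ⟨fun _ => lt_irrefl _⟩
    Finite.wellFounded_of_trans_of_irrefl _
  induction j using wf.induction with
  | _ j ih =>
  -- The entry (i, j) of `V k` is the conjugate of the entry (j, i) of its adjoint, which is again
  -- in the family and vanishes by induction at `i`.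
  have up : ∀ k ∈ s, ∀ i, l j < l i → V k i j = 0 := by
    intro k hk i hi
    obtain ⟨k', hk', hkk⟩ := hV k hk
    have := ih i hi k' hk' j hi.ne
    rw [← hkk, Matrix.conjTranspose_apply] at this
    simpa using this
  have hle : ∀ k ∈ s, ∀ i, Complex.normSq (V k i j) * (l i - l j) ≤ 0 := by
    intro k hk i
    rcases lt_or_ge (l j) (l i) with hi | hi
    · simp [up k hk i hi]
    · exact mul_nonpos_of_nonneg_of_nonpos (Complex.normSq_nonneg _) (sub_nonpos.2 hi)
  -- This is the (j, j) entry of the kernel equation. With the upward entries gone all its summands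
  -- are nonpositive, so each of them vanishes.
  have hsum : ∑ k ∈ s, c k * ∑ i, Complex.normSq (V k i j) * (l i - l j) = 0 := by
    have := congrFun (congrFun h0 j) j
    rw [Matrix.sum_apply] at this
    simp only [Matrix.smul_apply, jumpTerm_diagonal_apply, smul_eq_mul, Matrix.zero_apply] at this
    exact_mod_cast this
  rw [Finset.sum_eq_zero_iff_of_nonpos fun k hk => mul_nonpos_of_nonneg_of_nonpos (hc k hk).le
    (Finset.sum_nonpos fun i _ => hle k hk i)] at hsum
  intro k hk i hi
  have h1 := (mul_eq_zero.1 (hsum k hk)).resolve_left (hc k hk).ne'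
  rw [Finset.sum_eq_zero_iff_of_nonpos fun i _ => hle k hk i] at h1
  have h2 := (mul_eq_zero.1 (h1 i (Finset.mem_univ _))).resolve_right (sub_ne_zero.2 hi)
  exact Complex.normSq_eq_zero.1 h2

/-- Conjugation by the eigenvector unitary of `O` reduces to the diagonal case, where a matrix
without entries between distinct eigenvalues commutes with the diagonal one. -/
lemma commute_of_sum_jumpTerm_isHermitian (hc : ∀ k ∈ s, 0 < c k)
    (hV : ∀ k ∈ s, ∃ k' ∈ s, (V k)ᴴ = V k') {O : Matrix n n ℂ} (hO : O.IsHermitian)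
    (h0 : ∑ k ∈ s, (c k : ℂ) • jumpTerm (V k) O = 0) : ∀ k ∈ s, Commute (V k) O := by
  set U : Matrix n n ℂ := (hO.eigenvectorUnitary : Matrix n n ℂ) with hUdef
  have hU : U * Uᴴ = 1 := Unitary.mul_star_self_of_mem hO.eigenvectorUnitary.2
  have hU' : Uᴴ * U = 1 := Unitary.star_mul_self_of_mem hO.eigenvectorUnitary.2
  have hspec : O = U * Matrix.diagonal (fun i => (hO.eigenvalues i : ℂ)) * Uᴴ := by
    conv_lhs => rw [hO.spectral_theorem]
    rfl
  set D : Matrix n n ℂ := Matrix.diagonal (fun i => (hO.eigenvalues i : ℂ)) with hD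
  have hDO : Uᴴ * O * U = D := by
    rw [hspec, Matrix.mul_assoc, Matrix.mul_assoc, Matrix.mul_assoc, hU', Matrix.mul_one,
      ← Matrix.mul_assoc, hU', Matrix.one_mul]
  have h1 : ∑ k ∈ s, (c k : ℂ) • jumpTerm (Uᴴ * V k * U) D = 0 := by
    rw [← hDO]
    simp only [jumpTerm_conj U _ O hU]
    have : Uᴴ * (∑ k ∈ s, (c k : ℂ) • jumpTerm (V k) O) * U = 0 := by rw [h0]; simp
    rw [Finset.mul_sum, Finset.sum_mul] at this
    simpa only [Matrix.mul_smul, Matrix.smul_mul] using this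
  have h2 := eq_zero_of_sum_jumpTerm_diagonal (V := fun k => Uᴴ * V k * U) hc (fun k hk => by
    obtain ⟨k', hk', h⟩ := hV k hk
    refine ⟨k', hk', ?_⟩
    simp only [Matrix.conjTranspose_mul, Matrix.conjTranspose_conjTranspose, h, Matrix.mul_assoc])
    hO.eigenvalues h1
  intro k hk
  have h3 : Uᴴ * V k * U * D = D * (Uᴴ * V k * U) := by
    ext i j
    rw [hD, Matrix.mul_diagonal, Matrix.diagonal_mul]
    by_cases hij : hO.eigenvalues i = hO.eigenvalues j
    · rw [hij, mul_comm]
    · simp only [h2 j k hk i hij, zero_mul, mul_zero]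
  have h4 : ∀ X Y : Matrix n n ℂ, U * (Uᴴ * X * U * (Uᴴ * Y * U)) * Uᴴ = X * Y := by
    intro X Y
    have key : ∀ X : Matrix n n ℂ, U * (Uᴴ * X) = X := fun X => by
      rw [← Matrix.mul_assoc, hU, Matrix.one_mul]
    simp only [Matrix.mul_assoc, key, hU, Matrix.mul_one]
  rw [← hDO] at h3
  have h5 := congrArg (fun X => U * X * Uᴴ) h3
  simp only [h4] at h5
  exact h5

/-- The kernel of a Lindbladian without Hamiltonian part whose jump operators are closed under the
adjoint is the commutant of the jump operators. -/
theorem sum_jumpTerm_eq_zero_iff (hc : ∀ k ∈ s, 0 < c k)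
    (hV : ∀ k ∈ s, ∃ k' ∈ s, (V k)ᴴ = V k') (O : Matrix n n ℂ) :
    ∑ k ∈ s, (c k : ℂ) • jumpTerm (V k) O = 0 ↔ ∀ k ∈ s, Commute (V k) O := by
  constructor
  · intro h0
    have h0' : ∑ k ∈ s, (c k : ℂ) • jumpTerm (V k) Oᴴ = 0 := by
      have := congrArg Matrix.conjTranspose h0
      rw [Matrix.conjTranspose_sum, Matrix.conjTranspose_zero] at this
      simpa only [jumpTerm_conjTranspose, Matrix.conjTranspose_smul, Complex.star_def,
        Complex.conj_ofReal] using this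
    -- The kernel is stable under the adjoint, so it contains the Hermitian matrices O + Oᴴ and i(O
    -- - Oᴴ), which together span `O`.
    have hre := commute_of_sum_jumpTerm_isHermitian hc hV (O := O + Oᴴ)
      (by rw [Matrix.IsHermitian, Matrix.conjTranspose_add, Matrix.conjTranspose_conjTranspose,
            add_comm])
      (by simp only [map_add, smul_add, Finset.sum_add_distrib, h0, h0', add_zero])
    have him := commute_of_sum_jumpTerm_isHermitian hc hV (O := Complex.I • (O - Oᴴ))
      (by rw [Matrix.IsHermitian, Matrix.conjTranspose_smul, Matrix.conjTranspose_sub,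
            Matrix.conjTranspose_conjTranspose]
          simp [← smul_neg])
      (by
        simp only [map_smul, map_sub, smul_comm _ Complex.I, ← Finset.smul_sum, smul_sub,
          Finset.sum_sub_distrib, h0, h0']
        simp)
    intro k hk
    have hO : O = (1 / 2 : ℂ) • (O + Oᴴ) + (-Complex.I / 2) • (Complex.I • (O - Oᴴ)) := by
      rw [smul_smul, show -Complex.I / 2 * Complex.I = 1 / 2 by
        linear_combination (-1 / 2 : ℂ) * Complex.I_mul_I, ← smul_add]
      rw [show O + Oᴴ + (O - Oᴴ) = (2 : ℂ) • O by rw [two_smul]; abel, smul_smul]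
      norm_num
    rw [hO]
    exact ((hre k hk).smul_right _).add_right ((him k hk).smul_right _)
  · intro h
    refine Finset.sum_eq_zero fun k hk => ?_
    obtain ⟨k', hk', hkk⟩ := hV k hk
    rw [jumpTerm_eq_zero_of_commute (h k hk) (hkk ▸ h k' hk'), smul_zero]

end Lindblad

/-! ### Spectral projections and frequency components -/

section SpectralProjections

variable {n : Type*} [Fintype n] [DecidableEq n] {H : Matrix n n ℂ}

lemma toEuclideanCLM_spectralProj (H : Matrix n n ℂ) (l : ℝ) :
    Matrix.toEuclideanCLM (n := n) (𝕜 := ℂ) (spectralProj H l) =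
      (Module.End.eigenspace
      ((Matrix.toEuclideanCLM (n := n) (𝕜 := ℂ) H : EuclideanSpace ℂ n →L[ℂ] EuclideanSpace ℂ n) :
        EuclideanSpace ℂ n →ₗ[ℂ] EuclideanSpace ℂ n) (l : ℂ)).starProjection :=
  StarAlgEquiv.apply_symm_apply _ _

lemma mul_spectralProj (H : Matrix n n ℂ) (l : ℝ) :
    H * spectralProj H l = (l : ℂ) • spectralProj H l := by
  apply EquivLike.injective (Matrix.toEuclideanCLM (n := n) (𝕜 := ℂ))
  rw [map_mul, map_smul, toEuclideanCLM_spectralProj]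
  ext1 v
  have := Submodule.starProjection_apply_mem (Module.End.eigenspace
      ((Matrix.toEuclideanCLM (n := n) (𝕜 := ℂ) H : EuclideanSpace ℂ n →L[ℂ] EuclideanSpace ℂ n) :
        EuclideanSpace ℂ n →ₗ[ℂ] EuclideanSpace ℂ n) (l : ℂ)) v
  exact Module.End.mem_eigenspace_iff.1 this

lemma conjTranspose_spectralProj (H : Matrix n n ℂ) (l : ℝ) :
    (spectralProj H l)ᴴ = spectralProj H l := by
  apply EquivLike.injective (Matrix.toEuclideanCLM (n := n) (𝕜 := ℂ))
  rw [← Matrix.star_eq_conjTranspose, map_star, toEuclideanCLM_spectralProj]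
  exact (isSelfAdjoint_starProjection _).star_eq

lemma spectralProj_mul (hH : H.IsHermitian) (l : ℝ) :
    spectralProj H l * H = (l : ℂ) • spectralProj H l := by
  have := congrArg Matrix.conjTranspose (mul_spectralProj H l)
  rwa [Matrix.conjTranspose_mul, Matrix.conjTranspose_smul, conjTranspose_spectralProj, hH.eq,
    Complex.star_def, Complex.conj_ofReal] at this

/-- Checked on an eigenbasis: each eigenvector is fixed by the projection at its own eigenvalue and
killed by the others, eigenspaces of a Hermitian operator being orthogonal. -/
lemma sum_spectralProj (hH : H.IsHermitian) : ∑ l ∈ eigs H, spectralProj H l = 1 := by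
  apply EquivLike.injective (Matrix.toEuclideanCLM (n := n) (𝕜 := ℂ))
  rw [map_sum, map_one]
  apply ContinuousLinearMap.coe_injective
  refine hH.eigenvectorBasis.toBasis.ext fun j => ?_
  have hT : Matrix.toEuclideanCLM (n := n) (𝕜 := ℂ) H (hH.eigenvectorBasis j) =
      (hH.eigenvalues j : ℂ) • hH.eigenvectorBasis j := by
    have := hH.mulVec_eigenvectorBasis j
    ext i
    have := congrFun this i
    simpa using this
  have hsym : ((Matrix.toEuclideanCLM (n := n) (𝕜 := ℂ) H :
      EuclideanSpace ℂ n →L[ℂ] EuclideanSpace ℂ n) :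
        EuclideanSpace ℂ n →ₗ[ℂ] EuclideanSpace ℂ n).IsSymmetric :=
    Matrix.isSymmetric_toEuclideanLin_iff.2 hH
  have hmem : hH.eigenvectorBasis j ∈ Module.End.eigenspace
      ((Matrix.toEuclideanCLM (n := n) (𝕜 := ℂ) H : EuclideanSpace ℂ n →L[ℂ] EuclideanSpace ℂ n) :
        EuclideanSpace ℂ n →ₗ[ℂ] EuclideanSpace ℂ n) (hH.eigenvalues j : ℂ) :=
    Module.End.mem_eigenspace_iff.2 hT
  have hjs : hH.eigenvalues j ∈ eigs H := by
    rw [eigs, Set.Finite.mem_toFinset]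
    exact hH.eigenvalues_mem_spectrum_real j
  simp only [OrthonormalBasis.coe_toBasis, ContinuousLinearMap.coe_coe,
    sum_apply, one_apply_eq_self]
  rw [Finset.sum_eq_single_of_mem _ hjs]
  · rw [toEuclideanCLM_spectralProj]
    exact Submodule.starProjection_eq_self_iff.2 hmem
  · intro l _ hl
    rw [toEuclideanCLM_spectralProj]
    apply (Submodule.starProjection_apply_eq_zero_iff _).2
    rw [Submodule.mem_orthogonal]
    intro u hu
    have := hsym.orthogonalFamily_eigenspaces
      (i := (l : ℂ)) (j := (hH.eigenvalues j : ℂ)) (by exact_mod_cast hl) ⟨u, hu⟩ ⟨_, hmem⟩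
    exact this

lemma neg_mem_bohr {ω : ℝ} (h : ω ∈ bohr H) : -ω ∈ bohr H := by
  simp only [bohr, Finset.mem_image, Finset.mem_product, Prod.exists] at h ⊢
  obtain ⟨a, b, ⟨ha, hb⟩, rfl⟩ := h
  exact ⟨b, a, ⟨hb, ha⟩, by ring⟩

/-- The adjoint swaps the two eigenvalues of each summand. This is why the family of all jump
operators is closed under the adjoint. -/
lemma conjTranspose_fourier (H Q : Matrix n n ℂ) (ω : ℝ) :
    (fourier H Q ω)ᴴ = fourier H Qᴴ (-ω) := by
  rw [fourier, fourier, Matrix.conjTranspose_sum]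
  refine Finset.sum_nbij' Prod.swap Prod.swap ?_ ?_ ?_ ?_ ?_
  · rintro ⟨a, b⟩ h
    simp only [Finset.mem_filter, Finset.mem_product, Prod.swap] at h ⊢
    exact ⟨⟨h.1.2, h.1.1⟩, by linarith [h.2]⟩
  · rintro ⟨a, b⟩ h
    simp only [Finset.mem_filter, Finset.mem_product, Prod.swap] at h ⊢
    exact ⟨⟨h.1.2, h.1.1⟩, by linarith [h.2]⟩
  · simp
  · simp
  · rintro ⟨a, b⟩ _
    simp [Matrix.conjTranspose_mul, conjTranspose_spectralProj, Matrix.mul_assoc]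

lemma sum_fourier (hH : H.IsHermitian) (Q : Matrix n n ℂ) : ∑ ω ∈ bohr H, fourier H Q ω = Q := by
  simp only [fourier, bohr]
  rw [Finset.sum_fiberwise_of_maps_to (fun l hl => Finset.mem_image_of_mem _ hl),
    Finset.sum_product]
  simp only [← Finset.mul_sum, ← Finset.sum_mul, sum_spectralProj hH, Matrix.one_mul,
    Matrix.mul_one]

/-- The frequency components are eigenvectors of the commutator with `H`, which makes linear algebra
for that map available in `commute_fourier_siteOp`. -/
lemma lie_fourier (hH : H.IsHermitian) (Q : Matrix n n ℂ) (ω : ℝ) :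
    H * fourier H Q ω - fourier H Q ω * H = (ω : ℂ) • fourier H Q ω := by
  rw [fourier, Finset.mul_sum, Finset.sum_mul, ← Finset.sum_sub_distrib, Finset.smul_sum]
  refine Finset.sum_congr rfl fun l hl => ?_
  rw [Matrix.mul_assoc _ _ H, spectralProj_mul hH, ← Matrix.mul_assoc, ← Matrix.mul_assoc,
    mul_spectralProj, ← (Finset.mem_filter.1 hl).2]
  simp only [Matrix.smul_mul, Matrix.mul_smul, ← sub_smul, Complex.ofReal_sub]

lemma lie_eq_sum_fourier (hH : H.IsHermitian) (Q : Matrix n n ℂ) :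
    H * Q - Q * H = ∑ ω ∈ bohr H, (ω : ℂ) • fourier H Q ω := by
  conv_lhs => rw [← sum_fourier hH Q]
  rw [Finset.mul_sum, Finset.sum_mul, ← Finset.sum_sub_distrib]
  exact Finset.sum_congr rfl fun ω _ => lie_fourier hH Q ω

/-- A subspace that is invariant under a linear map and contains a sum of eigenvectors to
distinct eigenvalues contains each of them. -/
lemma mem_of_sum_eigenvectors_mem {K E ι : Type*} [Field K] [AddCommGroup E] [Module K E]
    (f : E →ₗ[K] E) (W : Submodule K E) (hW : ∀ x ∈ W, f x ∈ W) {t : Finset ι} {μ : ι → K}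
    (hμ : Set.InjOn μ t) {v : ι → E} (hv : ∀ i ∈ t, f (v i) = μ i • v i)
    (hsum : ∑ i ∈ t, v i ∈ W) {i : ι} (hi : i ∈ t) : v i ∈ W := by
  classical
  induction t using Finset.induction_on generalizing v i with
  | empty => simp at hi
  | insert a t ha ih =>
    have hμt : Set.InjOn μ t := hμ.mono (by simp)
    have ht : ∀ j ∈ t, v j ∈ W := by
      intro j hj
      -- Applying `f - μ a` kills the summand at `a` and multiplies each other one by a nonzero
      -- scalar, leaving a shorter sum of eigenvectors.
      have h1 : f (∑ i ∈ insert a t, v i) - μ a • ∑ i ∈ insert a t, v i ∈ W :=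
        W.sub_mem (hW _ hsum) (W.smul_mem _ hsum)
      have h2 : f (∑ i ∈ insert a t, v i) - μ a • ∑ i ∈ insert a t, v i =
          ∑ i ∈ t, (μ i - μ a) • v i := by
        rw [map_sum, Finset.smul_sum, ← Finset.sum_sub_distrib, Finset.sum_insert ha,
          hv a (Finset.mem_insert_self _ _), sub_self, zero_add]
        refine Finset.sum_congr rfl fun i hi => ?_
        rw [hv i (Finset.mem_insert_of_mem hi), sub_smul]
      rw [h2] at h1
      have h3 := ih hμt (v := fun i => (μ i - μ a) • v i) (fun i hi => by
        rw [map_smul, hv i (Finset.mem_insert_of_mem hi), smul_comm]) h1 hj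
      refine (W.smul_mem_iff (sub_ne_zero.2 fun h => ha ?_)).1 h3
      exact hμ (by simp [hj]) (by simp) h ▸ hj
    rcases Finset.mem_insert.1 hi with rfl | hi
    · rw [Finset.sum_insert ha] at hsum
      exact (W.add_mem_iff_left (W.sum_mem ht)).1 hsum
    · exact ht i hi

end SpectralProjections

/-! ### Weyl relations between translations and characters -/

section Weyl

variable {K : Type*} [DecidableEq K]

lemma leftReg_one [Group K] : leftReg (1 : K) = 1 := by
  ext x y
  simp [leftReg, Matrix.one_apply]

lemma leftReg_mul_leftReg [Group K] [Fintype K] (u v : K) :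
    leftReg u * leftReg v = leftReg (u * v) := by
  ext x y
  simp [leftReg, Matrix.mul_apply, mul_assoc]

lemma conjTranspose_leftReg [Group K] (u : K) : (leftReg u)ᴴ = leftReg u⁻¹ := by
  ext x y
  simp [leftReg, Matrix.conjTranspose_apply, apply_ite, eq_comm, eq_inv_mul_iff_mul_eq]

lemma charOp_one [Group K] : charOp (1 : K →* Circle) = 1 := by
  simp [charOp]

lemma charOp_mul_charOp [Group K] [Fintype K] (χ ψ : K →* Circle) :
    charOp χ * charOp ψ = charOp (χ * ψ) := by
  simp [charOp]

lemma conjTranspose_charOp [Group K] (χ : K →* Circle) : (charOp χ)ᴴ = charOp χ⁻¹ := by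
  rw [charOp, charOp, Matrix.diagonal_conjTranspose]
  congr 1
  ext x
  rw [Pi.star_apply, Complex.star_def, ← Circle.coe_inv_eq_conj, MonoidHom.inv_apply]

/-- The Weyl relation. Besides `K = G` it is applied to the group `Edge N → G` of configurations,
where star unitaries are translations and plaquette unitaries are characters. -/
lemma charOp_mul_leftReg [Group K] [Fintype K] (χ : K →* Circle) (u : K) :
    charOp χ * leftReg u = (χ u : ℂ) • (leftReg u * charOp χ) := by
  ext x y
  rw [charOp, Matrix.diagonal_mul, Matrix.smul_apply, Matrix.mul_diagonal]
  by_cases h : x = u * y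
  · simp [leftReg, h]
  · simp [leftReg, h]

lemma charOp_conj_leftReg [Group K] [Fintype K] (χ : K →* Circle) (u : K) :
    charOp χ * leftReg u * (charOp χ)ᴴ = (χ u : ℂ) • leftReg u := by
  rw [charOp_mul_leftReg, conjTranspose_charOp, Matrix.smul_mul, Matrix.mul_assoc,
    charOp_mul_charOp, mul_inv_cancel, charOp_one, Matrix.mul_one]

lemma leftReg_conj_charOp [Group K] [Fintype K] (χ : K →* Circle) (u : K) :
    leftReg u * charOp χ * (leftReg u)ᴴ = ((χ u)⁻¹ : ℂ) • charOp χ := by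
  rw [conjTranspose_leftReg, Matrix.mul_assoc, charOp_mul_leftReg, Matrix.mul_smul,
    ← Matrix.mul_assoc, leftReg_mul_leftReg, mul_inv_cancel, leftReg_one, Matrix.one_mul, map_inv,
    Circle.coe_inv]

lemma commute_charOp [Group K] [Fintype K] (χ ψ : K →* Circle) :
    Commute (charOp χ) (charOp ψ) := by
  rw [Commute, SemiconjBy, charOp_mul_charOp, charOp_mul_charOp, mul_comm]

lemma commute_leftReg [CommGroup K] [Fintype K] (u v : K) : Commute (leftReg u) (leftReg v) := by
  rw [Commute, SemiconjBy, leftReg_mul_leftReg, leftReg_mul_leftReg, mul_comm]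

lemma commute_charOp_leftReg [Group K] [Fintype K] {χ : K →* Circle} {u : K} (h : χ u = 1) :
    Commute (charOp χ) (leftReg u) := by
  rw [Commute, SemiconjBy, charOp_mul_leftReg, h, Circle.coe_one, one_smul]

end Weyl

/-! ### Orthogonality of characters -/

section Orthogonality

variable {G : Type*} [CommGroup G] [Fintype G]

lemma exists_character_ne_one {g : G} (hg : g ≠ 1) : ∃ χ : G →* Circle, χ g ≠ 1 := by
  obtain ⟨ψ, hψ⟩ := AddChar.exists_apply_ne_zero.2
    (show (Additive.ofMul g : Additive G) ≠ 0 from hg)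
  obtain ⟨φ, rfl⟩ := AddChar.circleEquivComplex.surjective ψ
  refine ⟨{ toFun := fun a => φ (Additive.ofMul a)
            map_one' := φ.map_zero_eq_one
            map_mul' := fun a b => φ.map_add_eq_mul _ _ }, fun h => hψ ?_⟩
  have h1 : φ (Additive.ofMul g) = 1 := h
  change ((φ (Additive.ofMul g) : Circle) : ℂ) = 1
  rw [h1, Circle.coe_one]

/-- Multiplying all characters by some ψ with ψ g ≠ 1 permutes them, so the sum equals ψ g times
itself. -/
lemma sum_characters_apply_of_ne_one {g : G} (hg : g ≠ 1) :
    ∑ χ : G →* Circle, (χ g : ℂ) = 0 := by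
  obtain ⟨ψ, hψ⟩ := exists_character_ne_one hg
  have h : (ψ g : ℂ) * ∑ χ : G →* Circle, (χ g : ℂ) = ∑ χ : G →* Circle, (χ g : ℂ) := by
    rw [Finset.mul_sum]
    exact Fintype.sum_equiv (Equiv.mulLeft ψ) _ _ fun χ => by simp
  by_contra h0
  exact hψ (Circle.ext (by simpa using mul_right_cancel₀ h0 (h.trans (one_mul _).symm)))

lemma sum_apply_of_character_ne_one {χ : G →* Circle} (hχ : χ ≠ 1) : ∑ g : G, (χ g : ℂ) = 0 := by
  obtain ⟨a, ha⟩ := DFunLike.ne_iff.1 hχ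
  have h : (χ a : ℂ) * ∑ g : G, (χ g : ℂ) = ∑ g : G, (χ g : ℂ) := by
    rw [Finset.mul_sum]
    exact Fintype.sum_equiv (Equiv.mulLeft a) _ _ fun g => by simp
  by_contra h0
  exact ha (Circle.ext (by simpa using mul_right_cancel₀ h0 (h.trans (one_mul _).symm)))

end Orthogonality

/-! ### Operators on single edges and on the complement of a region -/

section SiteOperators

variable {N : ℕ} [NeZero N] {G : Type*}

lemma tensorOp_mul [Fintype G] (P Q : Edge N → Matrix G G ℂ) :
    tensorOp P * tensorOp Q = tensorOp fun e => P e * Q e := by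
  ext x y
  simp only [tensorOp, Matrix.mul_apply, Matrix.of_apply, ← Finset.prod_mul_distrib]
  rw [Finset.prod_univ_sum, Fintype.piFinset_univ]

variable [DecidableEq G]

lemma tensorOp_leftReg [Group G] (u : Edge N → G) :
    tensorOp (fun e => leftReg (u e)) = leftReg u := by
  ext x y
  simp [tensorOp, leftReg, Finset.prod_ite_zero, funext_iff]

lemma tensorOp_charOp [Group G] (χ : Edge N → G →* Circle) :
    tensorOp (fun e => charOp (χ e)) =
      charOp (∏ e, (χ e).comp (Pi.evalMonoidHom (fun _ : Edge N => G) e)) := by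
  ext x y
  rw [tensorOp, charOp, Matrix.of_apply, Matrix.diagonal_apply, MonoidHom.finsetProd_apply,
    show ∀ f : Edge N → Circle, ((∏ e, f e : Circle) : ℂ) = ∏ e, (f e : ℂ) from
      fun f => map_prod Circle.coeHom f _]
  simp only [charOp, Matrix.diagonal_apply, Finset.prod_ite_zero, Finset.mem_univ, true_imp_iff,
    funext_iff]
  rfl

lemma siteOp_leftReg [Group G] (e : Edge N) (g : G) :
    siteOp e (leftReg g) = leftReg (Pi.mulSingle (M := fun _ : Edge N => G) e g) := by
  rw [siteOp, ← tensorOp_leftReg]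
  congr 1
  ext1 e'
  by_cases h : e' = e
  · subst h; simp
  · simp [h, leftReg_one]

lemma siteOp_charOp [Group G] (e : Edge N) (χ : G →* Circle) :
    siteOp e (charOp χ) = charOp (χ.comp (Pi.evalMonoidHom (fun _ : Edge N => G) e)) := by
  have : charOp (χ.comp (Pi.evalMonoidHom (fun _ : Edge N => G) e)) =
      tensorOp (fun e' => charOp (if e' = e then χ else 1)) := by
    rw [tensorOp_charOp]
    congr 1
    ext x
    rw [MonoidHom.finsetProd_apply, Finset.prod_eq_single e]
    · simp
    · intro b _ hb
      simp [hb]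
    · simp
  rw [siteOp, this]
  congr 1
  ext1 e'
  by_cases h : e' = e
  · subst h; simp
  · simp [h, charOp_one]

lemma siteOp_commute_tensorOp [Fintype G] {e : Edge N} {X : Matrix G G ℂ}
    {Q : Edge N → Matrix G G ℂ} (h : Commute X (Q e)) : Commute (siteOp e X) (tensorOp Q) := by
  rw [Commute, SemiconjBy, siteOp, tensorOp_mul, tensorOp_mul]
  congr 1
  ext1 e'
  by_cases he : e' = e
  · subst he; simpa using h.eq
  · simp [he]

lemma siteOp_apply (e : Edge N) (X : Matrix G G ℂ) (x y : Edge N → G) :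
    siteOp e X x y = if ∀ e' ≠ e, x e' = y e' then X (x e) (y e) else 0 := by
  rw [siteOp, tensorOp, Matrix.of_apply, ← Finset.mul_prod_erase _ _ (Finset.mem_univ e)]
  rw [Function.update_self]
  rw [Finset.prod_congr rfl (g := fun e' => if x e' = y e' then (1 : ℂ) else 0)]
  · rw [Finset.prod_ite_zero]
    simp
  · intro e' he'
    simp [(Finset.mem_erase.1 he').1, Matrix.one_apply]

lemma conjTranspose_siteOp (e : Edge N) (X : Matrix G G ℂ) : (siteOp e X)ᴴ = siteOp e Xᴴ := by
  ext x y
  simp only [Matrix.conjTranspose_apply, siteOp_apply, apply_ite star, star_zero, eq_comm]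

lemma oneTensor_apply_update (R : Finset (Edge N)) {e : Edge N} (he : e ∈ R)
    (Q : Matrix ({e : Edge N // e ∉ R} → G) ({e : Edge N // e ∉ R} → G) ℂ) (x y : Edge N → G)
    (a b : G) :
    oneTensor R Q (Function.update x e a) (Function.update y e b) =
      if a = b ∧ ∀ e' ∈ R, e' ≠ e → x e' = y e' then Q (fun e => x e) (fun e => y e) else 0 := by
  have h : ∀ (z : Edge N → G) (c : G), (fun e' : {e' // e' ∉ R} => Function.update z e c e') =
      fun e' : {e' // e' ∉ R} => z e' := by
    intro z c
    ext e'
    rw [Function.update_of_ne]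
    rintro rfl
    exact e'.2 he
  rw [oneTensor, Matrix.of_apply, h, h]
  congr 1
  simp only [eq_iff_iff]
  constructor
  · intro H
    refine ⟨by simpa using H e he, fun e' he' hne => by simpa [hne] using H e' he'⟩
  · rintro ⟨rfl, H⟩ e' he'
    by_cases hne : e' = e
    · subst hne; simp
    · simpa [hne] using H e' he' hne

variable [Fintype G]

lemma siteOp_mul_apply (e : Edge N) (X : Matrix G G ℂ) (O : Op N G) (x y : Edge N → G) :
    (siteOp e X * O) x y = ∑ a, X (x e) a * O (Function.update x e a) y := by
  rw [Matrix.mul_apply]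
  symm
  refine Fintype.sum_of_injective (Function.update x e) (Function.update_injective x e) _ _ ?_ ?_
  · intro z hz
    rw [siteOp_apply, if_neg, zero_mul]
    intro h
    refine hz ⟨z e, ?_⟩
    ext e'
    by_cases he : e' = e
    · subst he; simp
    · simp [he, h e' he]
  · intro a
    rw [siteOp_apply, if_pos (fun e' he => by simp [he])]
    simp

lemma mul_siteOp_apply (e : Edge N) (X : Matrix G G ℂ) (O : Op N G) (x y : Edge N → G) :
    (O * siteOp e X) x y = ∑ a, O x (Function.update y e a) * X a (y e) := by
  rw [Matrix.mul_apply]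
  symm
  refine Fintype.sum_of_injective (Function.update y e) (Function.update_injective y e) _ _ ?_ ?_
  · intro z hz
    rw [siteOp_apply, if_neg, mul_zero]
    intro h
    refine hz ⟨z e, ?_⟩
    ext e'
    by_cases he : e' = e
    · subst he; simp
    · simp [he, h e' he]
  · intro a
    rw [siteOp_apply, if_pos (fun e' he => by simp [he])]
    simp

/-- The block of an operator on the edge `e` between two configurations of the other edges. -/
def slice (e : Edge N) (O : Op N G) (x y : Edge N → G) : Matrix G G ℂ :=
  Matrix.of fun a b => O (Function.update x e a) (Function.update y e b)

/-- An operator on `e` acts separately on each block with the other edges frozen. So a commutant on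
one edge controls the commutant on the whole torus. -/
lemma commute_siteOp_iff (e : Edge N) (X : Matrix G G ℂ) (O : Op N G) :
    Commute (siteOp e X) O ↔ ∀ x y, Commute X (slice e O x y) := by
  have h1 : ∀ x y a b, (X * slice e O x y) a b =
      (siteOp e X * O) (Function.update x e a) (Function.update y e b) := by
    intro x y a b
    rw [siteOp_mul_apply, Matrix.mul_apply]
    simp [slice]
  have h2 : ∀ x y a b, (slice e O x y * X) a b =
      (O * siteOp e X) (Function.update x e a) (Function.update y e b) := by
    intro x y a b
    rw [mul_siteOp_apply, Matrix.mul_apply]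
    simp [slice]
  constructor
  · intro h x y
    ext a b
    rw [h1, h2, h.eq]
  · intro h
    ext x y
    have := congrFun (congrFun (h x y).eq (x e)) (y e)
    rwa [h1, h2, Function.update_eq_self, Function.update_eq_self] at this

/-- An operator that commutes with a set of operators on one edge with trivial commutant commutes
with all operators on this edge. -/
lemma commute_siteOp_of_forall_mem {e : Edge N} {T : Set (Matrix G G ℂ)}
    (hT : Set.centralizer T = Set.centralizer Set.univ) {O : Op N G}
    (h : ∀ X ∈ T, Commute (siteOp e X) O) (X : Matrix G G ℂ) : Commute (siteOp e X) O := by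
  rw [commute_siteOp_iff]
  intro x y
  have : slice e O x y ∈ Set.centralizer T := fun Y hY => (commute_siteOp_iff e Y O).1 (h Y hY) x y
  rw [hT] at this
  exact this X trivial

lemma oneTensor_commute_siteOp {R : Finset (Edge N)} {e : Edge N} (he : e ∈ R)
    (Q : Matrix ({e : Edge N // e ∉ R} → G) ({e : Edge N // e ∉ R} → G) ℂ) (X : Matrix G G ℂ) :
    Commute (siteOp e X) (oneTensor R Q) := by
  rw [commute_siteOp_iff]
  intro x y
  have : slice e (oneTensor R Q) x y =
      (if ∀ e' ∈ R, e' ≠ e → x e' = y e' then Q (fun e => x e) (fun e => y e) else 0) •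
        (1 : Matrix G G ℂ) := by
    ext a b
    rw [slice, Matrix.of_apply, oneTensor_apply_update R he, Matrix.smul_apply, Matrix.one_apply]
    by_cases hab : a = b <;> simp [hab]
  rw [this]
  exact (Commute.one_right X).smul_right _

/-- For the converse two kinds of operators on `R` suffice: diagonal matrix units force the entries
of `O` to vanish unless both configurations agree on `R`, and translations make the other entries
independent of the common value there. -/
lemma mem_range_oneTensor_iff [CommGroup G] (R : Finset (Edge N)) (O : Op N G) :
    O ∈ Set.range (oneTensor R) ↔ ∀ e ∈ R, ∀ X, Commute (siteOp e X) O := by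
  constructor
  · rintro ⟨Q, rfl⟩ e he X
    exact oneTensor_commute_siteOp he Q X
  intro h
  have hzero : ∀ x y, ∀ e ∈ R, x e ≠ y e → O x y = 0 := by
    intro x y e he hxy
    have := congrFun (congrFun (h e he (Matrix.single (x e) (x e) 1)).eq x) y
    rw [siteOp_mul_apply, mul_siteOp_apply, Finset.sum_eq_single (x e), Finset.sum_eq_zero] at this
    · simpa using this
    · intro a _
      rw [Matrix.single_apply_of_col_ne _ _ hxy, mul_zero]
    · intro a _ ha
      rw [Matrix.single_apply_of_col_ne _ _ ha.symm, zero_mul]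
    · simp
  have hshift : ∀ u : Edge N → G, (∀ e ∉ R, u e = 1) → Commute (leftReg u) O := by
    intro u hu
    rw [← Finset.univ_prod_mulSingle u]
    refine Finset.prod_induction (fun e => Pi.mulSingle (M := fun _ : Edge N => G) e (u e))
      (fun v => Commute (leftReg v) O) ?_ ?_ ?_
    · intro a b ha hb
      rw [← leftReg_mul_leftReg]
      exact ha.mul_left hb
    · rw [leftReg_one]
      exact Commute.one_left O
    · intro e _
      by_cases he : e ∈ R
      · rw [← siteOp_leftReg]
        exact h e he _
      · rw [hu e he, Pi.mulSingle_one, leftReg_one]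
        exact Commute.one_left O
  have hinv : ∀ u : Edge N → G, (∀ e ∉ R, u e = 1) → ∀ x y, O x (u * y) = O (u⁻¹ * x) y := by
    intro u hu x y
    have := congrFun (congrFun (hshift u hu).eq x) (y)
    rw [Matrix.mul_apply, Matrix.mul_apply, Finset.sum_eq_single (u⁻¹ * x),
      Finset.sum_eq_single (u * y)] at this
    · simpa [leftReg] using this.symm
    · intro z _ hz
      simp [leftReg, hz]
    · simp
    · intro z _ hz
      simp [leftReg, ← inv_mul_eq_iff_eq_mul, hz.symm]
    · simp
  -- The operator on the complement is read off from the entries at configurations equal to 1 on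
  -- `R`; translating by the inverse of the common restriction to `R` brings any other nonzero entry
  -- there.
  refine ⟨Matrix.of fun a b => O (fun e => if he : e ∈ R then 1 else a ⟨e, he⟩)
    (fun e => if he : e ∈ R then 1 else b ⟨e, he⟩), ?_⟩
  ext x y
  rw [oneTensor, Matrix.of_apply]
  split_ifs with hxy
  · rw [Matrix.of_apply]
    have h1 : y = (fun e => if e ∈ R then y e else 1) *
        fun e => if he : e ∈ R then 1 else y e := by
      ext e
      by_cases he : e ∈ R <;> simp [he]
    have h2 : (fun e => if he : e ∈ R then 1 else x e) =
        (fun e => if e ∈ R then y e else 1)⁻¹ * x := by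
      ext e
      by_cases he : e ∈ R
      · simp [he, hxy e he]
      · simp [he]
    conv_rhs => rw [h1, hinv _ (fun e he => by simp [he]), ← h2]
  · push Not at hxy
    obtain ⟨e, he, hne⟩ := hxy
    rw [hzero x y e he hne]

end SiteOperators

/-! ### Incidence and separation on the torus -/

section Lattice

variable {N : ℕ}

lemma inl_mem_starEdges {v s : Vertex N} :
    Sum.inl v ∈ starEdges s ↔ s = v ∨ s = (v.1 - 1, v.2) := by
  simp only [starEdges, starPos, starNeg, Finset.mem_union, Finset.mem_insert,
    Finset.mem_singleton, Sum.inl.injEq, reduceCtorEq, or_false, Prod.ext_iff]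
  grind

lemma inr_mem_starEdges {v s : Vertex N} :
    Sum.inr v ∈ starEdges s ↔ s = v ∨ s = (v.1, v.2 - 1) := by
  simp only [starEdges, starPos, starNeg, Finset.mem_union, Finset.mem_insert,
    Finset.mem_singleton, Sum.inr.injEq, reduceCtorEq, false_or, Prod.ext_iff]
  grind

lemma inl_mem_plaqEdges {v p : Plaquette N} :
    Sum.inl v ∈ plaqEdges p ↔ p = v ∨ p = (v.1, v.2 + 1) := by
  simp only [plaqEdges, plaqPos, plaqNeg, Finset.mem_union, Finset.mem_insert,
    Finset.mem_singleton, Sum.inl.injEq, reduceCtorEq, or_false, Prod.ext_iff]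
  grind

lemma inr_mem_plaqEdges {v p : Plaquette N} :
    Sum.inr v ∈ plaqEdges p ↔ p = v ∨ p = (v.1 + 1, v.2) := by
  simp only [plaqEdges, plaqPos, plaqNeg, Finset.mem_union, Finset.mem_insert,
    Finset.mem_singleton, Sum.inr.injEq, reduceCtorEq, false_or, Prod.ext_iff]
  grind

/-- Every edge lies in exactly two members of a family of edge sets: given one of them, there is a
unique other one. -/
def InTwo {V E : Type*} (inc : V → Finset E) : Prop :=
  ∀ e v, e ∈ inc v → ∃ v', v' ≠ v ∧ e ∈ inc v' ∧ ∀ w, e ∈ inc w → w = v ∨ w = v'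

lemma inTwo_of_pair {V E : Type*} {inc : V → Finset E}
    (h : ∀ e, ∃ a b, a ≠ b ∧ ∀ v, e ∈ inc v ↔ v = a ∨ v = b) : InTwo inc := by
  intro e v hv
  obtain ⟨a, b, hab, he⟩ := h e
  rcases (he v).1 hv with rfl | rfl
  · exact ⟨b, hab.symm, (he b).2 (Or.inr rfl), fun w hw => (he w).1 hw⟩
  · exact ⟨a, hab, (he a).2 (Or.inl rfl), fun w hw => ((he w).1 hw).symm⟩

variable [Nontrivial (ZMod N)]

lemma inTwo_starEdges : InTwo (starEdges (N := N)) := by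
  refine inTwo_of_pair ?_
  rintro (v | v)
  · exact ⟨_, _, by simp [Prod.ext_iff, eq_sub_iff_add_eq], fun _ => inl_mem_starEdges⟩
  · exact ⟨_, _, by simp [Prod.ext_iff, eq_sub_iff_add_eq], fun _ => inr_mem_starEdges⟩

lemma inTwo_plaqEdges : InTwo (plaqEdges (N := N)) := by
  refine inTwo_of_pair ?_
  rintro (v | v)
  · exact ⟨_, _, by simp [Prod.ext_iff], fun _ => inl_mem_plaqEdges⟩
  · exact ⟨_, _, by simp [Prod.ext_iff], fun _ => inr_mem_plaqEdges⟩

/-- Two edges that lie in the same two plaquettes and in a common star are equal. -/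
lemma eq_of_mem_plaqEdges_of_mem_starEdges {a b : Edge N} {p q : Plaquette N} {s : Vertex N}
    (hpq : p ≠ q) (hap : a ∈ plaqEdges p) (haq : a ∈ plaqEdges q) (hbp : b ∈ plaqEdges p)
    (hbq : b ∈ plaqEdges q) (has : a ∈ starEdges s) (hbs : b ∈ starEdges s) : a = b := by
  -- The common star matters only for N = 2, where two neighbouring plaquettes share two parallel
  -- edges; for larger N they share a single edge.
  have h1 : (1 : ZMod N) ≠ 0 := one_ne_zero
  obtain ⟨p1, p2⟩ := p
  obtain ⟨q1, q2⟩ := q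
  obtain ⟨s1, s2⟩ := s
  rcases a with ⟨a1, a2⟩ | ⟨a1, a2⟩ <;> rcases b with ⟨b1, b2⟩ | ⟨b1, b2⟩ <;>
    simp only [inl_mem_starEdges, inr_mem_starEdges, inl_mem_plaqEdges, inr_mem_plaqEdges,
      Prod.ext_iff, ne_eq, Sum.inl.injEq, Sum.inr.injEq, reduceCtorEq] at * <;> grind

/-- Two edges that lie in the same two stars and in a common plaquette are equal. -/
lemma eq_of_mem_starEdges_of_mem_plaqEdges {a b : Edge N} {s t : Vertex N} {p : Plaquette N}
    (hst : s ≠ t) (has : a ∈ starEdges s) (hat : a ∈ starEdges t) (hbs : b ∈ starEdges s)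
    (hbt : b ∈ starEdges t) (hap : a ∈ plaqEdges p) (hbp : b ∈ plaqEdges p) : a = b := by
  have h1 : (1 : ZMod N) ≠ 0 := one_ne_zero
  obtain ⟨p1, p2⟩ := p
  obtain ⟨t1, t2⟩ := t
  obtain ⟨s1, s2⟩ := s
  rcases a with ⟨a1, a2⟩ | ⟨a1, a2⟩ <;> rcases b with ⟨b1, b2⟩ | ⟨b1, b2⟩ <;>
    simp only [inl_mem_starEdges, inr_mem_starEdges, inl_mem_plaqEdges, inr_mem_plaqEdges,
      Prod.ext_iff, ne_eq, Sum.inl.injEq, Sum.inr.injEq, reduceCtorEq] at * <;> grind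

omit [Nontrivial (ZMod N)] in
/-- If `R` is connected with respect to two families of edge sets, then two sets of the first family
that share an edge of `R` are separated by an edge of `R`. -/
lemma exists_separating_edge {V W E : Type*} {inc : V → Finset E} {inc' : W → Finset E}
    {R : Finset E} (hinc : InTwo inc)
    (huniq : ∀ a b v v' w, v ≠ v' → a ∈ inc v → a ∈ inc v' → b ∈ inc v → b ∈ inc v' →
      a ∈ inc' w → b ∈ inc' w → a = b)
    (hconn : ∀ e ∈ R, ∀ e' ∈ R, Relation.ReflTransGen
      (fun a b : E => a ∈ R ∧ b ∈ R ∧ ∃ v, a ∈ inc v ∧ b ∈ inc v) e e')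
    (hconn' : ∀ e ∈ R, ∀ e' ∈ R, Relation.ReflTransGen
      (fun a b : E => a ∈ R ∧ b ∈ R ∧ ∃ w, a ∈ inc' w ∧ b ∈ inc' w) e e')
    (hR : 2 ≤ R.card) {e : E} (he : e ∈ R) {v v' : V} (hv : v ≠ v') (hev : e ∈ inc v)
    (hev' : e ∈ inc v') :
    ∃ e' ∈ R, (e' ∈ inc v ∧ e' ∉ inc v') ∨ (e' ∉ inc v ∧ e' ∈ inc v') := by
  by_contra hno
  push Not at hno
  have hpair : ∀ a, a ∈ inc v → a ∈ inc v' → ∀ w, a ∈ inc w → w = v ∨ w = v' := by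
    intro a ha ha' w hw
    obtain ⟨x, hx, hax, hall⟩ := hinc a v ha
    rcases hall v' ha' with h | rfl
    · exact absurd h.symm hv
    · exact hall w hw
  -- An edge in both `v` and `v'` lies in no other set of the family. So the next edge of a path
  -- lies in one of the two, and without a separating edge in both.
  have hall : ∀ e' ∈ R, e' ∈ inc v ∧ e' ∈ inc v' := by
    intro e' he'
    induction hconn e he e' he' with
    | refl => exact ⟨hev, hev'⟩
    | tail hab hbc ih =>
      obtain ⟨hb, hc, w, hbw, hcw⟩ := hbc
      obtain ⟨h1, h2⟩ := ih hb
      rcases hpair _ h1 h2 w hbw with rfl | rfl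
      · exact ⟨hcw, (hno _ hc).1 hcw⟩
      · exact ⟨by_contra fun h => (hno _ hc).2 h hcw, hcw⟩
  -- Now every edge of `R` lies in the same two sets, so by `huniq` a path in the second sense never
  -- moves. That contradicts |R| ≥ 2.
  have heq : ∀ e' ∈ R, e' = e := by
    intro e' he'
    induction hconn' e he e' he' with
    | refl => rfl
    | tail hab hbc ih =>
      obtain ⟨hb, hc, w, hbw, hcw⟩ := hbc
      obtain rfl := ih hb
      exact (huniq _ _ v v' w hv hev hev' (hall _ hc).1 (hall _ hc).2 hbw hcw).symm
  have : R.card ≤ 1 := Finset.card_le_one.2 fun a ha b hb => (heq a ha).trans (heq b hb).symm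
  omega

end Lattice

/-! ### Averaging over unitaries on an edge -/

section Twirl

variable {A : Type*} [Ring A] [Algebra ℂ A]

/-- Averages over edges of `R` detect the local terms of a Hamiltonian one by one, if any two of
them that share an edge of `R` are separated by an edge of `R`. -/
lemma commute_of_twirl {V E : Type*} [Fintype V] {inc : V → Finset E} {R : Finset E}
    (hinc : InTwo inc)
    (hsep : ∀ e ∈ R, ∀ v v', v ≠ v' → e ∈ inc v → e ∈ inc v' →
      ∃ e' ∈ R, (e' ∈ inc v ∧ e' ∉ inc v') ∨ (e' ∉ inc v ∧ e' ∈ inc v'))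
    {T : V → A} {O H H' : A} {τ : E → A →ₗ[ℂ] A} {m c : ℂ} (hm : m ≠ 0)
    (hH : H = -(∑ v, T v) - H')
    (hlie : ∀ e ∈ R, ∀ X, τ e (O * X - X * O) = O * τ e X - τ e X * O)
    (hK : ∀ e ∈ R, τ e (O * H - H * O) = m • (O * H - H * O))
    (hH' : ∀ e ∈ R, τ e H' = m • H')
    (hT : ∀ e ∈ R, ∀ v, e ∉ inc v → τ e (T v) = m • T v)
    (hT' : ∀ e ∈ R, ∀ v, e ∈ inc v → τ e (T v) = algebraMap ℂ A c)
    {v : V} {e : E} (he : e ∈ R) (hev : e ∈ inc v) : Commute O (T v) := by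
  classical
  obtain ⟨v', hv', hev', hall⟩ := hinc e v hev
  -- Only the two terms containing `e` survive in the difference, up to the scalar `2 * c`, one `c`
  -- from each.
  have hdiff : m • H - τ e H =
      -(m • (T v + T v') - algebraMap ℂ A (2 * c)) := by
    have h1 : ∑ w, (m • T w - τ e (T w)) = m • (T v + T v') - algebraMap ℂ A (2 * c) := by
      rw [← Finset.sum_subset (Finset.subset_univ {v, v'}), Finset.sum_pair hv'.symm,
        hT' e he v hev, hT' e he v' hev', two_mul, map_add, smul_add]
      · abel
      · intro w _ hw
        rw [hT e he w, sub_self]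
        intro h
        rcases hall w h with rfl | rfl <;> simp at hw
    rw [← h1, hH, map_sub, map_neg, map_sum, hH' e he, smul_sub, smul_neg, Finset.smul_sum,
      Finset.sum_sub_distrib]
    abel
  -- The commutator of `O` with `τ e H` is `τ e` of its commutator with `H`, which by `hK` is just
  -- `m` times the latter.
  have hcomm : Commute O (m • H - τ e H) := by
    have h1 := hlie e he H
    rw [hK e he] at h1
    rw [Commute, SemiconjBy, ← sub_eq_zero, mul_sub, sub_mul, mul_smul_comm, smul_mul_assoc]
    rw [smul_sub] at h1
    rw [← sub_eq_zero] at h1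
    rw [← h1]
    abel
  have hpair : Commute O (T v + T v') := by
    rw [hdiff] at hcomm
    have h1 : T v + T v' = m⁻¹ • (algebraMap ℂ A (2 * c) -
        -(m • (T v + T v') - algebraMap ℂ A (2 * c)) - (0 : A)) := by
      rw [sub_zero, sub_neg_eq_add, add_sub_cancel, smul_smul, inv_mul_cancel₀ hm, one_smul]
    rw [h1]
    exact (((Algebra.commute_algebraMap_right (2 * c) O).sub_right hcomm).sub_right
      (Commute.zero_right O)).smul_right _
  -- Averaging over the separating edge makes the term at `w` a scalar and only rescales the one at
  -- `w'`, which is thereby isolated.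
  have haux : ∀ w w' : V, Commute O (T w + T w') → ∀ e' ∈ R, e' ∈ inc w → e' ∉ inc w' →
      Commute O (T w') := by
    intro w w' hww e' he' hw hw'
    have h1 := hlie e' he' (T w + T w')
    rw [sub_eq_zero.2 hww.eq, map_zero, map_add, hT' e' he' w hw, hT e' he' w' hw'] at h1
    have h2 : Commute O (algebraMap ℂ A c + m • T w') := sub_eq_zero.1 h1.symm
    have h3 : T w' = m⁻¹ • ((algebraMap ℂ A c + m • T w') - algebraMap ℂ A c) := by
      rw [add_sub_cancel_left, smul_smul, inv_mul_cancel₀ hm, one_smul]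
    rw [h3]
    exact (h2.sub_right (Algebra.commute_algebraMap_right c O)).smul_right _
  obtain ⟨e', he', ⟨h1, h2⟩ | ⟨h1, h2⟩⟩ := hsep e he v v' hv'.symm hev hev'
  · have h3 := hpair.sub_right (haux v v' hpair e' he' h1 h2)
    rwa [add_sub_cancel_right] at h3
  · exact haux v' v (add_comm (T v) (T v') ▸ hpair) e' he' h2 h1

variable [StarRing A]

/-- The sum of the conjugates of `X` by the operators `U γ`. -/
def twirl {Γ : Type*} [Fintype Γ] (U : Γ → A) : A →ₗ[ℂ] A :=
  ∑ γ, LinearMap.mulLeftRight ℂ (U γ, star (U γ))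

lemma twirl_apply {Γ : Type*} [Fintype Γ] (U : Γ → A) (X : A) :
    twirl U X = ∑ γ, U γ * X * star (U γ) := by
  simp [twirl]

lemma twirl_lie {Γ : Type*} [Fintype Γ] {U : Γ → A} {O : A} (h : ∀ γ, Commute (U γ) O)
    (h' : ∀ γ, Commute (star (U γ)) O) (X : A) :
    twirl U (O * X - X * O) = O * twirl U X - twirl U X * O := by
  simp only [twirl_apply, Finset.mul_sum, Finset.sum_mul, ← Finset.sum_sub_distrib]
  refine Finset.sum_congr rfl fun γ _ => ?_
  rw [mul_sub, sub_mul, ← mul_assoc (U γ) O X, (h γ).eq, mul_assoc (U γ) (X * O), mul_assoc X,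
    ← (h' γ).eq]
  simp only [mul_assoc]

lemma twirl_of_commute {Γ : Type*} [Fintype Γ] {U : Γ → A} (hU : ∀ γ, U γ * star (U γ) = 1) {X : A}
    (h : ∀ γ, Commute (U γ) X) : twirl U X = (Fintype.card Γ : ℂ) • X := by
  rw [twirl_apply, Finset.sum_congr rfl fun γ _ => by rw [(h γ).eq, mul_assoc, hU, mul_one]]
  simp [Nat.cast_smul_eq_nsmul]

end Twirl

/-! ### Star and plaquette operators as translations and characters -/

section StarsAndPlaquettes

variable {N : ℕ} {G : Type*} [CommGroup G]

/-- The configuration by which `A_s(g)` translates. -/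
def starShift (s : Vertex N) (g : G) : Edge N → G := fun e =>
  (if e ∈ starPos s then g else 1) * (if e ∈ starNeg s then g⁻¹ else 1)

lemma starShift_inv (s : Vertex N) (g : G) : starShift s g⁻¹ = (starShift s g)⁻¹ := by
  ext e
  simp only [starShift, Pi.inv_apply]
  split_ifs <;> simp

lemma starShift_one (s : Vertex N) : starShift s (1 : G) = 1 := by
  ext e
  simp [starShift]

lemma starShift_apply_of_notMem {s : Vertex N} {e : Edge N} (h : e ∉ starEdges s) (g : G) :
    starShift s g e = 1 := by
  rw [starEdges, Finset.notMem_union] at h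
  simp [starShift, h]

lemma notMem_starNeg_of_mem_starPos [Nontrivial (ZMod N)] {s : Vertex N} {e : Edge N}
    (h : e ∈ starPos s) : e ∉ starNeg s := by
  simp only [starPos, starNeg, Finset.mem_insert, Finset.mem_singleton] at h ⊢
  rcases h with rfl | rfl <;> simp [Prod.ext_iff]

lemma notMem_plaqNeg_of_mem_plaqPos [Nontrivial (ZMod N)] {p : Plaquette N} {e : Edge N}
    (h : e ∈ plaqPos p) : e ∉ plaqNeg p := by
  simp only [plaqPos, plaqNeg, Finset.mem_insert, Finset.mem_singleton] at h ⊢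
  rcases h with rfl | rfl <;> simp [Prod.ext_iff, eq_sub_iff_add_eq]

/-- For N ≥ 2 no edge both leaves and enters the same vertex, so exactly one of the two factors is
present. -/
lemma starShift_apply_of_mem [Nontrivial (ZMod N)] {s : Vertex N} {e : Edge N}
    (h : e ∈ starEdges s) :
    (∀ g : G, starShift s g e = g) ∨ ∀ g : G, starShift s g e = g⁻¹ := by
  by_cases hp : e ∈ starPos s
  · exact Or.inl fun g => by simp [starShift, hp, notMem_starNeg_of_mem_starPos hp]
  · have hn : e ∈ starNeg s := (Finset.mem_union.1 h).resolve_left hp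
    exact Or.inr fun g => by simp [starShift, hp, hn]

/-- On the torus with a single vertex, both ends of an edge belong to the same star. -/
lemma starShift_of_subsingleton [Subsingleton (ZMod N)] (s : Vertex N) (g : G) :
    starShift s g = 1 := by
  ext e
  rcases e with e | e <;> simp [starShift, starPos, starNeg, eq_iff_true_of_subsingleton]

variable [NeZero N]

/-- The character by which `B_p(χ)` multiplies. -/
noncomputable def plaqPhase (p : Plaquette N) (χ : G →* Circle) : (Edge N → G) →* Circle :=
  ∏ e, ((if e ∈ plaqPos p then χ else 1) * (if e ∈ plaqNeg p then χ⁻¹ else 1)).comp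
    (Pi.evalMonoidHom (fun _ : Edge N => G) e)

lemma plaqPhase_apply (p : Plaquette N) (χ : G →* Circle) (x : Edge N → G) :
    plaqPhase p χ x =
      ∏ e, (if e ∈ plaqPos p then χ (x e) else 1) * (if e ∈ plaqNeg p then (χ (x e))⁻¹ else 1) := by
  rw [plaqPhase, MonoidHom.finsetProd_apply]
  refine Finset.prod_congr rfl fun e _ => ?_
  rw [MonoidHom.comp_apply, MonoidHom.mul_apply, Pi.evalMonoidHom_apply]
  split_ifs <;> rfl

lemma plaqPhase_inv (p : Plaquette N) (χ : G →* Circle) :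
    plaqPhase p χ⁻¹ = (plaqPhase p χ)⁻¹ := by
  refine MonoidHom.ext fun x => ?_
  rw [MonoidHom.inv_apply, plaqPhase_apply, plaqPhase_apply, ← Finset.prod_inv_distrib]
  refine Finset.prod_congr rfl fun e _ => ?_
  rw [MonoidHom.inv_apply]
  split_ifs <;> simp

lemma plaqPhase_one (p : Plaquette N) : plaqPhase p (1 : G →* Circle) = 1 := by
  refine MonoidHom.ext fun x => ?_
  simp [plaqPhase_apply]

lemma plaqPhase_mulSingle (p : Plaquette N) (χ : G →* Circle) (e : Edge N) (g : G) :
    plaqPhase p χ (Pi.mulSingle (M := fun _ : Edge N => G) e g) =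
      (if e ∈ plaqPos p then χ g else 1) * (if e ∈ plaqNeg p then (χ g)⁻¹ else 1) := by
  rw [plaqPhase_apply, Finset.prod_eq_single e]
  · rw [Pi.mulSingle_eq_same]
  · intro b _ hb
    simp [hb]
  · simp

lemma plaqPhase_mulSingle_of_mem [Nontrivial (ZMod N)] {p : Plaquette N} {e : Edge N}
    (h : e ∈ plaqEdges p) :
    (∀ (χ : G →* Circle) g, plaqPhase p χ (Pi.mulSingle (M := fun _ : Edge N => G) e g) = χ g) ∨
      ∀ (χ : G →* Circle) g,
        plaqPhase p χ (Pi.mulSingle (M := fun _ : Edge N => G) e g) = (χ g)⁻¹ := by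
  by_cases hp : e ∈ plaqPos p
  · exact Or.inl fun χ g => by simp [plaqPhase_mulSingle, hp, notMem_plaqNeg_of_mem_plaqPos hp]
  · have hn : e ∈ plaqNeg p := (Finset.mem_union.1 h).resolve_left hp
    exact Or.inr fun χ g => by simp [plaqPhase_mulSingle, hp, hn]

omit [NeZero N] in
lemma starShift_eq (s : Vertex N) (g : G) :
    starShift s g = Pi.mulSingle (M := fun _ : Edge N => G) (Sum.inl s) g *
      Pi.mulSingle (M := fun _ : Edge N => G) (Sum.inr s) g *
      (Pi.mulSingle (M := fun _ : Edge N => G) (Sum.inl (s.1 + 1, s.2)) g)⁻¹ *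
      (Pi.mulSingle (M := fun _ : Edge N => G) (Sum.inr (s.1, s.2 + 1)) g)⁻¹ := by
  ext e
  simp only [starShift, starPos, starNeg, Finset.mem_insert, Finset.mem_singleton, Pi.mul_apply,
    Pi.inv_apply, Pi.mulSingle_apply]
  rcases e with e | e <;> simp only [Sum.inl.injEq, Sum.inr.injEq, reduceCtorEq, or_false, false_or,
    if_false] <;> split_ifs <;> simp

/-- The holonomy of a plaquette does not change under a gauge transformation. -/
lemma plaqPhase_starShift (p : Plaquette N) (χ : G →* Circle) (s : Vertex N) (g : G) :
    plaqPhase p χ (starShift s g) = 1 := by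
  obtain ⟨s1, s2⟩ := s
  obtain ⟨p1, p2⟩ := p
  rw [starShift_eq]
  simp only [map_mul, map_inv, plaqPhase_mulSingle, plaqPos, plaqNeg, Finset.mem_insert,
    Finset.mem_singleton, Sum.inl.injEq, Sum.inr.injEq, reduceCtorEq, or_false, false_or,
    Prod.mk.injEq]
  -- All conditions now compare `s1` with `p1`, `p1 - 1` and `s2` with `p2`, `p2 - 1`; in each
  -- combination the phases cancel in pairs, for small N as well.
  have h1 : s1 + 1 = p1 ↔ s1 = p1 - 1 := eq_sub_iff_add_eq.symm
  have h2 : s2 + 1 = p2 ↔ s2 = p2 - 1 := eq_sub_iff_add_eq.symm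
  simp only [h1, h2]
  split_ifs <;> simp

lemma plaqPhase_of_subsingleton [Subsingleton (ZMod N)] (p : Plaquette N) (χ : G →* Circle) :
    plaqPhase p χ = 1 := by
  refine MonoidHom.ext fun x => ?_
  rw [plaqPhase_apply]
  refine Finset.prod_eq_one fun e _ => ?_
  rcases e with e | e <;> simp [plaqPos, plaqNeg, eq_iff_true_of_subsingleton]

variable [DecidableEq G] [Fintype G]

lemma starUnitary_eq (s : Vertex N) (g : G) : starUnitary s g = leftReg (starShift s g) := by
  rw [← tensorOp_leftReg, starUnitary]
  congr 1
  ext1 e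
  simp only [starShift, ← leftReg_mul_leftReg, apply_ite leftReg, leftReg_one]

lemma plaqUnitary_eq (p : Plaquette N) (χ : G →* Circle) :
    plaqUnitary p χ = charOp (plaqPhase p χ) := by
  rw [plaqPhase, ← tensorOp_charOp, plaqUnitary]
  congr 1
  ext1 e
  simp only [← charOp_mul_charOp, apply_ite charOp, charOp_one]

lemma starOp_eq (s : Vertex N) :
    starOp G s = (1 / (Fintype.card G : ℂ)) • ∑ g : G, leftReg (starShift s g) := by
  simp only [starOp, starUnitary_eq]

lemma plaqOp_eq (p : Plaquette N) :
    plaqOp G p =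
      (1 / (Fintype.card (G →* Circle) : ℂ)) • ∑ χ : G →* Circle, charOp (plaqPhase p χ) := by
  simp only [plaqOp, plaqUnitary_eq]

lemma starProj_one (s : Vertex N) : starProj s (1 : G →* Circle) = starOp G s := by
  simp [starProj, starOp]

lemma plaqProj_one (p : Plaquette N) : plaqProj p (1 : G) = plaqOp G p := by
  simp [plaqProj, plaqOp]

lemma commute_starOp {X : Op N G} {s : Vertex N} (h : ∀ g, Commute X (leftReg (starShift s g))) :
    Commute X (starOp G s) := by
  rw [starOp_eq]
  exact (Commute.sum_right _ _ _ fun g _ => h g).smul_right _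

lemma commute_plaqOp {X : Op N G} {p : Plaquette N} (h : ∀ χ, Commute X (charOp (plaqPhase p χ))) :
    Commute X (plaqOp G p) := by
  rw [plaqOp_eq]
  exact (Commute.sum_right _ _ _ fun χ _ => h χ).smul_right _

lemma starOp_commute_starOp (s t : Vertex N) : Commute (starOp G s) (starOp G t) :=
  commute_starOp fun g => (commute_starOp fun g' =>
    commute_leftReg (starShift t g) (starShift s g')).symm

lemma plaqOp_commute_plaqOp (p q : Plaquette N) : Commute (plaqOp G p) (plaqOp G q) :=
  commute_plaqOp fun χ => (commute_plaqOp fun χ' =>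
    commute_charOp (plaqPhase q χ) (plaqPhase p χ')).symm

lemma plaqOp_commute_starOp (p : Plaquette N) (s : Vertex N) :
    Commute (plaqOp G p) (starOp G s) :=
  commute_starOp fun g => (commute_plaqOp fun χ =>
    (commute_charOp_leftReg (plaqPhase_starShift p χ s g)).symm).symm

lemma siteOp_commute_starOp {e : Edge N} {s : Vertex N} (h : e ∉ starEdges s) (X : Matrix G G ℂ) :
    Commute (siteOp e X) (starOp G s) := by
  refine commute_starOp fun g => ?_
  rw [← tensorOp_leftReg]
  refine siteOp_commute_tensorOp ?_
  rw [starShift_apply_of_notMem h, leftReg_one]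
  exact Commute.one_right X

lemma siteOp_commute_plaqOp {e : Edge N} {p : Plaquette N} (h : e ∉ plaqEdges p)
    (X : Matrix G G ℂ) : Commute (siteOp e X) (plaqOp G p) := by
  refine commute_plaqOp fun χ => ?_
  rw [plaqPhase, ← tensorOp_charOp]
  refine siteOp_commute_tensorOp ?_
  rw [plaqEdges, Finset.notMem_union] at h
  rw [if_neg h.1, if_neg h.2, mul_one, charOp_one]
  exact Commute.one_right X

lemma siteOp_charOp_commute_plaqOp (e : Edge N) (χ : G →* Circle) (p : Plaquette N) :
    Commute (siteOp e (charOp χ)) (plaqOp G p) := by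
  rw [siteOp_charOp]
  exact commute_plaqOp fun _ => commute_charOp _ _

lemma siteOp_leftReg_commute_starOp (e : Edge N) (g : G) (s : Vertex N) :
    Commute (siteOp e (leftReg g)) (starOp G s) := by
  rw [siteOp_leftReg]
  exact commute_starOp fun _ => commute_leftReg _ _

lemma conjTranspose_starOp (s : Vertex N) : (starOp G s)ᴴ = starOp G s := by
  rw [starOp_eq, Matrix.conjTranspose_smul, Matrix.conjTranspose_sum]
  congr 1
  · simp
  · exact Fintype.sum_equiv (Equiv.inv G) _ _ fun g => by
      rw [conjTranspose_leftReg, Equiv.inv_apply, starShift_inv]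

lemma conjTranspose_plaqOp (p : Plaquette N) : (plaqOp G p)ᴴ = plaqOp G p := by
  rw [plaqOp_eq, Matrix.conjTranspose_smul, Matrix.conjTranspose_sum]
  congr 1
  · simp
  · exact Fintype.sum_equiv (Equiv.inv (G →* Circle)) _ _ fun χ => by
      rw [conjTranspose_charOp, Equiv.inv_apply, plaqPhase_inv]

omit [DecidableEq G] [CommGroup G] [Fintype G] in
lemma starsMeeting_univ : starsMeeting (Finset.univ : Finset (Edge N)) = Finset.univ := by
  refine Finset.filter_true_of_mem fun s _ => ⟨Sum.inl s, ?_⟩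
  simp [inl_mem_starEdges]

omit [DecidableEq G] [CommGroup G] [Fintype G] in
lemma plaqsMeeting_univ : plaqsMeeting (Finset.univ : Finset (Edge N)) = Finset.univ := by
  refine Finset.filter_true_of_mem fun s _ => ⟨Sum.inl s, ?_⟩
  simp [inl_mem_plaqEdges]

variable (N G) in
lemma hamiltonian_univ : hamiltonian G (Finset.univ : Finset (Edge N)) =
    -(∑ s, starOp G s) - ∑ p, plaqOp G p := by
  rw [hamiltonian, starsMeeting_univ, plaqsMeeting_univ]

variable (N G) in
lemma isHermitian_hamiltonian : (hamiltonian G (Finset.univ : Finset (Edge N))).IsHermitian := by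
  simp only [Matrix.IsHermitian, hamiltonian, Matrix.conjTranspose_sub, Matrix.conjTranspose_neg,
    Matrix.conjTranspose_sum, conjTranspose_starOp, conjTranspose_plaqOp]

lemma siteOp_charOp_mul_star (e : Edge N) (χ : G →* Circle) :
    siteOp e (charOp χ) * star (siteOp e (charOp χ)) = 1 := by
  rw [siteOp_charOp, Matrix.star_eq_conjTranspose, conjTranspose_charOp, charOp_mul_charOp,
    mul_inv_cancel, charOp_one]

lemma siteOp_leftReg_mul_star (e : Edge N) (g : G) :
    siteOp e (leftReg g) * star (siteOp e (leftReg g)) = 1 := by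
  rw [siteOp_leftReg, Matrix.star_eq_conjTranspose, conjTranspose_leftReg, leftReg_mul_leftReg,
    mul_inv_cancel, leftReg_one]

/-- By the Weyl relation each translation only picks up a phase. Summed over χ this yields the
average `twirl_starOp`; for a single χ it yields the generalized star operators. -/
lemma siteOp_charOp_conj_starOp (e : Edge N) (χ : G →* Circle) (s : Vertex N) :
    siteOp e (charOp χ) * starOp G s * star (siteOp e (charOp χ)) =
      (1 / (Fintype.card G : ℂ)) • ∑ g : G, (χ (starShift s g e) : ℂ) • leftReg (starShift s g) := by
  rw [siteOp_charOp, starOp_eq, Matrix.mul_smul, Matrix.smul_mul, Finset.mul_sum, Finset.sum_mul]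
  simp only [Matrix.star_eq_conjTranspose, charOp_conj_leftReg]
  rfl

lemma siteOp_leftReg_conj_plaqOp (e : Edge N) (g : G) (p : Plaquette N) :
    siteOp e (leftReg g) * plaqOp G p * star (siteOp e (leftReg g)) =
      (1 / (Fintype.card (G →* Circle) : ℂ)) • ∑ χ : G →* Circle,
        ((plaqPhase p χ (Pi.mulSingle (M := fun _ : Edge N => G) e g))⁻¹ : ℂ) •
          charOp (plaqPhase p χ) := by
  rw [siteOp_leftReg, plaqOp_eq, Matrix.mul_smul, Matrix.smul_mul, Finset.mul_sum, Finset.sum_mul]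
  simp only [Matrix.star_eq_conjTranspose, leftReg_conj_charOp]

/-- The translation by `g` gets the coefficient ∑ χ(g) or ∑ χ(g⁻¹), so orthogonality leaves only the
identity. The equality of the two cardinalities is not needed. -/
lemma twirl_starOp [Nontrivial (ZMod N)] {e : Edge N} {s : Vertex N} (h : e ∈ starEdges s) :
    twirl (fun χ : G →* Circle => siteOp e (charOp χ)) (starOp G s) =
      algebraMap ℂ _ (Fintype.card (G →* Circle) / Fintype.card G : ℂ) := by
  simp only [twirl_apply, siteOp_charOp_conj_starOp]
  rw [← Finset.smul_sum, Finset.sum_comm, Finset.sum_eq_single 1]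
  · simp [starShift_one, leftReg_one, Algebra.algebraMap_eq_smul_one, ← Nat.cast_smul_eq_nsmul ℂ,
      smul_smul, div_eq_inv_mul]
  · intro g _ hg
    rw [← Finset.sum_smul, sum_characters_apply_of_ne_one, zero_smul]
    rcases starShift_apply_of_mem (G := G) h with h | h <;> simpa [h] using hg
  · simp

lemma twirl_plaqOp [Nontrivial (ZMod N)] {e : Edge N} {p : Plaquette N} (h : e ∈ plaqEdges p) :
    twirl (fun g : G => siteOp e (leftReg g)) (plaqOp G p) =
      algebraMap ℂ _ (Fintype.card G / Fintype.card (G →* Circle) : ℂ) := by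
  simp only [twirl_apply, siteOp_leftReg_conj_plaqOp]
  rw [← Finset.smul_sum, Finset.sum_comm, Finset.sum_eq_single 1]
  · simp [plaqPhase_one, charOp_one, Algebra.algebraMap_eq_smul_one, ← Nat.cast_smul_eq_nsmul ℂ,
      smul_smul, div_eq_inv_mul]
  · intro χ _ hχ
    rw [← Finset.sum_smul]
    rcases plaqPhase_mulSingle_of_mem (G := G) h with h | h
    · have := sum_apply_of_character_ne_one (inv_ne_one.2 hχ)
      simp only [MonoidHom.inv_apply, Circle.coe_inv] at this
      simp only [h, this, zero_smul]
    · simp only [h, Circle.coe_inv, inv_inv, sum_apply_of_character_ne_one hχ, zero_smul]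
  · simp

lemma starOp_of_subsingleton [Subsingleton (ZMod N)] (s : Vertex N) : starOp G s = 1 := by
  rw [starOp_eq]
  simp [starShift_of_subsingleton, leftReg_one, ← Nat.cast_smul_eq_nsmul ℂ, smul_smul]

lemma plaqOp_of_subsingleton [Subsingleton (ZMod N)] (p : Plaquette N) : plaqOp G p = 1 := by
  rw [plaqOp_eq]
  simp [plaqPhase_of_subsingleton, charOp_one, ← Nat.cast_smul_eq_nsmul ℂ, smul_smul]

/-- The generalized star operators are conjugates of the star operator by operators on any edge of
the star. -/
lemma commute_starProj {O : Op N G} {s : Vertex N} {e : Edge N} (he : e ∈ starEdges s)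
    (hO : ∀ X, Commute (siteOp e X) O) (hs : Commute (starOp G s) O) (χ : G →* Circle) :
    Commute (starProj s χ) O := by
  have h0 : starProj s χ = (1 / (Fintype.card G : ℂ)) •
      ∑ g : G, (χ g : ℂ) • leftReg (starShift s g) := by
    simp only [starProj, starUnitary_eq]
  have hconj : ∀ ψ : G →* Circle, (∀ g, ψ (starShift s g e) = χ g) → Commute (starProj s χ) O := by
    intro ψ hψ
    have h1 := siteOp_charOp_conj_starOp e ψ s
    simp only [hψ] at h1
    rw [h0, ← h1, Matrix.star_eq_conjTranspose, conjTranspose_siteOp]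
    exact ((hO _).mul_left hs).mul_left (hO _)
  rcases subsingleton_or_nontrivial (ZMod N) with h | h
  · rw [h0]
    refine Commute.smul_left (Commute.sum_left _ _ _ fun g _ => ?_) _
    rw [starShift_of_subsingleton, leftReg_one]
    exact (Commute.one_left O).smul_left _
  -- The conjugating character is χ or χ⁻¹ according to whether the edge leaves or enters the
  -- vertex.
  · rcases starShift_apply_of_mem (G := G) he with h | h
    · exact hconj χ fun g => by rw [h]
    · exact hconj χ⁻¹ fun g => by rw [h]; simp

/-- The generalized plaquette operators are conjugates of the plaquette operator by operators on
any edge of the plaquette. -/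
lemma commute_plaqProj {O : Op N G} {p : Plaquette N} {e : Edge N} (he : e ∈ plaqEdges p)
    (hO : ∀ X, Commute (siteOp e X) O) (hp : Commute (plaqOp G p) O) (g : G) :
    Commute (plaqProj p g) O := by
  have h0 : plaqProj p g = (1 / (Fintype.card (G →* Circle) : ℂ)) •
      ∑ χ : G →* Circle, (χ g : ℂ) • charOp (plaqPhase p χ) := by
    simp only [plaqProj, plaqUnitary_eq]
  have hconj : ∀ a : G, (∀ χ : G →* Circle,
      (plaqPhase p χ (Pi.mulSingle (M := fun _ : Edge N => G) e a))⁻¹ = χ g) →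
      Commute (plaqProj p g) O := by
    intro a ha
    have h1 := siteOp_leftReg_conj_plaqOp e a p
    simp only [← Circle.coe_inv, ha] at h1
    rw [h0, ← h1, Matrix.star_eq_conjTranspose, conjTranspose_siteOp]
    exact ((hO _).mul_left hp).mul_left (hO _)
  rcases subsingleton_or_nontrivial (ZMod N) with h | h
  · rw [h0]
    refine Commute.smul_left (Commute.sum_left _ _ _ fun g _ => ?_) _
    rw [plaqPhase_of_subsingleton, charOp_one]
    exact (Commute.one_left O).smul_left _
  -- Conjugating a character by a translation produces the inverse phase, hence `g⁻¹` on the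
  -- counterclockwise edges.
  · rcases plaqPhase_mulSingle_of_mem (G := G) he with h | h
    · exact hconj g⁻¹ fun χ => by rw [h]; simp
    · exact hconj g fun χ => by rw [h]; simp

end StarsAndPlaquettes

/-! ### From commutants of jump operators to stars and plaquettes -/

section Kernel

variable {N : ℕ} [NeZero N] {G : Type*} [CommGroup G] [Fintype G] [DecidableEq G]

/-- If `O` and `[H, O]` commute with all operators on the edges of `R`, then `O` commutes with the
star operators that meet `R`. -/
lemma commute_starOp_of_commute_lie {R : Finset (Edge N)} (hstar : StarConnected R)
    (hplaq : PlaquetteConnected R) (hR : 2 ≤ R.card) {O : Op N G}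
    (hO : ∀ e ∈ R, ∀ X, Commute (siteOp e X) O)
    (hK : ∀ e ∈ R, ∀ X, Commute (siteOp e X)
      (O * hamiltonian G Finset.univ - hamiltonian G Finset.univ * O))
    {s : Vertex N} {e : Edge N} (he : e ∈ R) (hes : e ∈ starEdges s) :
    Commute O (starOp G s) := by
  rcases subsingleton_or_nontrivial (ZMod N) with h | h
  · rw [starOp_of_subsingleton]
    exact Commute.one_right O
  -- The average runs over the diagonal unitaries M^χ on `e`: they commute with every plaquette
  -- term, so the plaquette sum plays the part of `H'`.
  refine commute_of_twirl (inc := starEdges) (R := R) inTwo_starEdges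
    (fun e he v v' => exists_separating_edge inTwo_starEdges
      (fun a b v v' w => eq_of_mem_starEdges_of_mem_plaqEdges) hstar hplaq hR he)
    (τ := fun e => twirl fun χ : G →* Circle => siteOp e (charOp χ))
    (m := Fintype.card (G →* Circle))
    (c := Fintype.card (G →* Circle) / Fintype.card G) (by simp) (hamiltonian_univ N G) ?_ ?_ ?_ ?_ ?_ he hes
  · intro e he X
    refine twirl_lie (fun χ => hO e he _) (fun χ => ?_) X
    rw [Matrix.star_eq_conjTranspose, conjTranspose_siteOp]
    exact hO e he _
  · exact fun e he => twirl_of_commute (siteOp_charOp_mul_star e) fun χ => hK e he _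
  · exact fun e he => twirl_of_commute (siteOp_charOp_mul_star e) fun χ =>
      Commute.sum_right _ _ _ fun p _ => siteOp_charOp_commute_plaqOp e χ p
  · exact fun e he s hs => twirl_of_commute (siteOp_charOp_mul_star e) fun χ =>
      siteOp_commute_starOp hs _
  · exact fun e he s hs => twirl_starOp hs

/-- If `O` and `[H, O]` commute with all operators on the edges of `R`, then `O` commutes with the
plaquette operators that meet `R`. -/
lemma commute_plaqOp_of_commute_lie {R : Finset (Edge N)} (hstar : StarConnected R)
    (hplaq : PlaquetteConnected R) (hR : 2 ≤ R.card) {O : Op N G}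
    (hO : ∀ e ∈ R, ∀ X, Commute (siteOp e X) O)
    (hK : ∀ e ∈ R, ∀ X, Commute (siteOp e X)
      (O * hamiltonian G Finset.univ - hamiltonian G Finset.univ * O))
    {p : Plaquette N} {e : Edge N} (he : e ∈ R) (hep : e ∈ plaqEdges p) :
    Commute O (plaqOp G p) := by
  rcases subsingleton_or_nontrivial (ZMod N) with h | h
  · rw [plaqOp_of_subsingleton]
    exact Commute.one_right O
  refine commute_of_twirl (inc := plaqEdges) (R := R) inTwo_plaqEdges
    (fun e he v v' => exists_separating_edge inTwo_plaqEdges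
      (fun a b v v' w => eq_of_mem_plaqEdges_of_mem_starEdges) hplaq hstar hR he)
    (τ := fun e => twirl fun g : G => siteOp e (leftReg g))
    (m := Fintype.card G) (c := Fintype.card G / Fintype.card (G →* Circle)) (by simp)
    (H' := ∑ s, starOp G s)
    ((hamiltonian_univ N G).trans (neg_sub_comm _ _)) ?_ ?_ ?_ ?_ ?_ he hep
  · intro e he X
    refine twirl_lie (fun g => hO e he _) (fun g => ?_) X
    rw [Matrix.star_eq_conjTranspose, conjTranspose_siteOp]
    exact hO e he _
  · exact fun e he => twirl_of_commute (siteOp_leftReg_mul_star e) fun g => hK e he _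
  · exact fun e he => twirl_of_commute (siteOp_leftReg_mul_star e) fun g =>
      Commute.sum_right _ _ _ fun s _ => siteOp_leftReg_commute_starOp e g s
  · exact fun e he p hp => twirl_of_commute (siteOp_leftReg_mul_star e) fun g =>
      siteOp_commute_plaqOp hp _
  · exact fun e he p hp => twirl_plaqOp hp

/-- An operator that commutes with an operator on the edge `e`, and with the stars and plaquettes
of `e`, commutes with the frequency components of the former. -/
lemma commute_fourier_siteOp {O : Op N G} {e : Edge N} {X : Matrix G G ℂ}
    (hX : Commute (siteOp e X) O) (hs : ∀ s, e ∈ starEdges s → Commute (starOp G s) O)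
    (hp : ∀ p, e ∈ plaqEdges p → Commute (plaqOp G p) O) {ω : ℝ}
    (hω : ω ∈ bohr (hamiltonian G (Finset.univ : Finset (Edge N)))) :
    Commute (fourier (hamiltonian G (Finset.univ : Finset (Edge N))) (siteOp e X) ω) O := by
  set H := hamiltonian G (Finset.univ : Finset (Edge N)) with hHdef
  have hherm : H.IsHermitian := isHermitian_hamiltonian N G
  -- `Hnear` collects the terms at `e`. `O` need not commute with `Hfar`, which commutes instead
  -- with the operator on `e`.
  obtain ⟨Hnear, Hfar, hH, hnear, hfar, hnf⟩ : ∃ Hnear Hfar : Op N G, H = Hnear + Hfar ∧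
      Commute Hnear O ∧ Commute Hfar (siteOp e X) ∧ Commute Hnear Hfar := by
    refine ⟨-(∑ s with e ∈ starEdges s, starOp G s) - ∑ p with e ∈ plaqEdges p, plaqOp G p,
      -(∑ s with e ∉ starEdges s, starOp G s) - ∑ p with e ∉ plaqEdges p, plaqOp G p,
      ?_, ?_, ?_, ?_⟩
    · rw [hHdef, hamiltonian_univ,
        ← Finset.sum_filter_add_sum_filter_not Finset.univ (fun s => e ∈ starEdges s),
        ← Finset.sum_filter_add_sum_filter_not Finset.univ (fun p => e ∈ plaqEdges p)]
      abel
    · exact ((Commute.sum_left _ _ _ fun s h => hs s (Finset.mem_filter.1 h).2).neg_left).sub_left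
        (Commute.sum_left _ _ _ fun p h => hp p (Finset.mem_filter.1 h).2)
    · exact ((Commute.sum_left _ _ _ fun s h =>
        (siteOp_commute_starOp (Finset.mem_filter.1 h).2 X).symm).neg_left).sub_left
        (Commute.sum_left _ _ _ fun p h =>
        (siteOp_commute_plaqOp (Finset.mem_filter.1 h).2 X).symm)
    · have ss : ∀ a b : Finset (Vertex N), Commute (∑ s ∈ a, starOp G s) (∑ s ∈ b, starOp G s) :=
        fun a b => Commute.sum_left _ _ _ fun s _ => Commute.sum_right _ _ _ fun t _ =>
          starOp_commute_starOp s t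
      have pp : ∀ a b : Finset (Plaquette N),
          Commute (∑ p ∈ a, plaqOp G p) (∑ p ∈ b, plaqOp G p) :=
        fun a b => Commute.sum_left _ _ _ fun p _ => Commute.sum_right _ _ _ fun q _ =>
          plaqOp_commute_plaqOp p q
      have ps : ∀ (a : Finset (Plaquette N)) (b : Finset (Vertex N)),
          Commute (∑ p ∈ a, plaqOp G p) (∑ s ∈ b, starOp G s) :=
        fun a b => Commute.sum_left _ _ _ fun p _ => Commute.sum_right _ _ _ fun s _ =>
          plaqOp_commute_starOp p s
      exact (((ss _ _).neg_left.neg_right).sub_right (ps _ _).symm.neg_left).sub_left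
        ((ps _ _).neg_right.sub_right (pp _ _))
  -- On the operators commuting with both `O` and `Hfar`, the commutator with `H` is the commutator
  -- with `Hnear`, which preserves them. So this subspace contains every eigencomponent of `siteOp e
  -- X`.
  let W : Submodule ℂ (Op N G) :=
    { carrier := {Y | Commute Y O ∧ Commute Hfar Y}
      add_mem' := fun ha hb => ⟨ha.1.add_left hb.1, ha.2.add_right hb.2⟩
      zero_mem' := ⟨Commute.zero_left _, Commute.zero_right _⟩
      smul_mem' := fun c _ ha => ⟨ha.1.smul_left c, ha.2.smul_right c⟩ }
  have hWstable : ∀ Y ∈ W, (LinearMap.mulLeft ℂ H - LinearMap.mulRight ℂ H) Y ∈ W := by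
    rintro Y ⟨h1, h2⟩
    have : (LinearMap.mulLeft ℂ H - LinearMap.mulRight ℂ H) Y = Hnear * Y - Y * Hnear := by
      rw [LinearMap.sub_apply, LinearMap.mulLeft_apply, LinearMap.mulRight_apply, hH, add_mul,
        mul_add, h2.eq]
      abel
    rw [this]
    exact ⟨(hnear.mul_left h1).sub_left (h1.mul_left hnear),
      (hnf.symm.mul_right h2).sub_right (h2.mul_right hnf.symm)⟩
  have hmem := mem_of_sum_eigenvectors_mem (LinearMap.mulLeft ℂ H - LinearMap.mulRight ℂ H) W
    hWstable (t := bohr H) (μ := fun ω => (ω : ℂ)) (v := fourier H (siteOp e X))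
    (fun a _ b _ hab => Complex.ofReal_injective hab)
    (fun ω _ => by
      rw [LinearMap.sub_apply, LinearMap.mulLeft_apply, LinearMap.mulRight_apply,
        lie_fourier hherm])
    (by rw [sum_fourier hherm]; exact ⟨hX, hfar⟩) hω
  exact hmem.1

/-! ### The kernel of the Davies generator -/

section Davies

variable {I : Type*} [Fintype I] {S : Edge N → I → Matrix G G ℂ} {h : Edge N → I → ℝ → ℝ}
  {R : Finset (Edge N)}

/-- The kernel of the Davies generator is the commutant of its jump operators. -/
lemma mem_ker_davies_iff
    (hadj : ∀ e, Set.range (fun i => (S e i).conjTranspose) = Set.range (S e))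
    (hpos : ∀ e i, ∀ ω ∈ bohr (hamiltonian G (Finset.univ : Finset (Edge N))), 0 < h e i ω)
    (O : Op N G) :
    O ∈ LinearMap.ker (davies S h R) ↔
      ∀ e ∈ R, ∀ i, ∀ ω ∈ bohr (hamiltonian G (Finset.univ : Finset (Edge N))),
        Commute (fourier (hamiltonian G (Finset.univ : Finset (Edge N))) (siteOp e (S e i)) ω)
          O := by
  set H := hamiltonian G (Finset.univ : Finset (Edge N)) with hHdef
  have key := sum_jumpTerm_eq_zero_iff
    (s := R ×ˢ ((Finset.univ : Finset I) ×ˢ bohr H)) (c := fun k => h k.1 k.2.1 k.2.2)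
    (V := fun k => fourier H (siteOp k.1 (S k.1 k.2.1)) k.2.2)
    (fun k hk => hpos _ _ _ (by simp only [Finset.mem_product] at hk; exact hk.2.2))
    (by
      rintro ⟨e, i, ω⟩ hk
      simp only [Finset.mem_product, Finset.mem_univ, true_and] at hk
      have hi : (S e i)ᴴ ∈ Set.range (S e) := hadj e ▸ Set.mem_range_self i
      obtain ⟨j, hj⟩ := hi
      refine ⟨(e, j, -ω), ?_, ?_⟩
      · simp [hk.1, neg_mem_bohr hk.2]
      · rw [conjTranspose_fourier, conjTranspose_siteOp, hj])
    O
  rw [LinearMap.mem_ker, davies, ← hHdef]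
  simp only [Finset.sum_product] at key
  simp only [LinearMap.sum_apply, LinearMap.smul_apply]
  rw [key]
  simp only [Finset.mem_product, Finset.mem_univ, true_and, Prod.forall]
  exact ⟨fun H e he i ω hω => H e i ω ⟨he, hω⟩, fun H e i ω hk => H e hk.1 i ω hk.2⟩

/-- Summing the jump operators over ω with weights 1 and ω recovers S and [H, S], the only
combinations needed for the forward direction; the backward one is `commute_fourier_siteOp`. -/
theorem mem_ker_davies_iff_commute
    (hadj : ∀ e, Set.range (fun i => (S e i).conjTranspose) = Set.range (S e))
    (herg : ∀ e, Set.centralizer (Set.range (S e)) =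
      Set.centralizer (Set.univ : Set (Matrix G G ℂ)))
    (hpos : ∀ e i, ∀ ω ∈ bohr (hamiltonian G (Finset.univ : Finset (Edge N))), 0 < h e i ω)
    (hstar : StarConnected R) (hplaq : PlaquetteConnected R) (hR : 2 ≤ R.card) (O : Op N G) :
    O ∈ LinearMap.ker (davies S h R) ↔
      (∀ e ∈ R, ∀ X, Commute (siteOp e X) O) ∧ (∀ s ∈ starsMeeting R, Commute (starOp G s) O) ∧
        ∀ p ∈ plaqsMeeting R, Commute (plaqOp G p) O := by
  rw [mem_ker_davies_iff hadj hpos]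
  set H := hamiltonian G (Finset.univ : Finset (Edge N)) with hHdef
  have hherm : H.IsHermitian := isHermitian_hamiltonian N G
  constructor
  · intro hO
    have hS : ∀ e ∈ R, ∀ i, Commute (siteOp e (S e i)) O := by
      intro e he i
      rw [← sum_fourier hherm (siteOp e (S e i))]
      exact Commute.sum_left _ _ _ fun ω hω => hO e he i ω hω
    have hHS : ∀ e ∈ R, ∀ i, Commute (H * siteOp e (S e i) - siteOp e (S e i) * H) O := by
      intro e he i
      rw [lie_eq_sum_fourier hherm (siteOp e (S e i))]
      exact Commute.sum_left _ _ _ fun ω hω => (hO e he i ω hω).smul_left _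
    have hsite : ∀ e ∈ R, ∀ X, Commute (siteOp e X) O := by
      refine fun e he X => commute_siteOp_of_forall_mem (herg e) ?_ X
      rintro _ ⟨i, rfl⟩
      exact hS e he i
    have hK : ∀ e ∈ R, ∀ X, Commute (siteOp e X) (O * H - H * O) := by
      refine fun e he X => commute_siteOp_of_forall_mem (herg e) ?_ X
      rintro _ ⟨i, rfl⟩
      have h1 := (hS e he i).eq
      have h2 := (hHS e he i).eq
      generalize siteOp e (S e i) = Y at h1 h2
      -- Both brackets on the right vanish, since `O` commutes with [H, Y] and with `Y`.
      have jacobi : Y * (O * H - H * O) - (O * H - H * O) * Y =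
          ((H * Y - Y * H) * O - O * (H * Y - Y * H)) +
            ((Y * O - O * Y) * H - H * (Y * O - O * Y)) := by
        noncomm_ring
      rw [h2, h1, sub_self, sub_self, zero_mul, mul_zero, sub_zero, add_zero] at jacobi
      exact sub_eq_zero.1 jacobi
    refine ⟨hsite, fun s hs => ?_, fun p hp => ?_⟩
    · obtain ⟨e, he⟩ := (Finset.mem_filter.1 hs).2
      obtain ⟨h1, h2⟩ := Finset.mem_inter.1 he
      exact (commute_starOp_of_commute_lie hstar hplaq hR hsite hK h2 h1).symm
    · obtain ⟨e, he⟩ := (Finset.mem_filter.1 hp).2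
      obtain ⟨h1, h2⟩ := Finset.mem_inter.1 he
      exact (commute_plaqOp_of_commute_lie hstar hplaq hR hsite hK h2 h1).symm
  · rintro ⟨hO, hs, hp⟩ e he i ω hω
    refine commute_fourier_siteOp (hO e he _) (fun s h1 => hs s ?_) (fun p h1 => hp p ?_) hω
    · exact Finset.mem_filter.2 ⟨Finset.mem_univ _, e, Finset.mem_inter.2 ⟨h1, he⟩⟩
    · exact Finset.mem_filter.2 ⟨Finset.mem_univ _, e, Finset.mem_inter.2 ⟨h1, he⟩⟩

end Davies

end Kernel

end QuantumDouble

theorem mainTheorem5 {N : ℕ} [NeZero N] {G : Type*} [CommGroup G] [Fintype G] [DecidableEq G]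
    {I : Type*} [Fintype I] (β : ℝ)
    -- bare jump operators: on each edge closed under the adjoint, with trivial commutant
    (S : QuantumDouble.Edge N → I → Matrix G G ℂ)
    (hadj : ∀ e, Set.range (fun i => (S e i).conjTranspose) = Set.range (S e))
    (herg : ∀ e, Set.centralizer (Set.range (S e)) =
      Set.centralizer (Set.univ : Set (Matrix G G ℂ)))
    -- jump rates: positive, with detailed balance at inverse temperature β
    (h : QuantumDouble.Edge N → I → ℝ → ℝ)
    (hpos : ∀ e i, ∀ ω ∈ QuantumDouble.bohr (QuantumDouble.hamiltonian G
      (Finset.univ : Finset (QuantumDouble.Edge N))), 0 < h e i ω)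
    (hdb : ∀ e i, ∀ ω ∈ QuantumDouble.bohr (QuantumDouble.hamiltonian G
      (Finset.univ : Finset (QuantumDouble.Edge N))),
      h e i (-ω) = h e i ω * Real.exp (-β * ω))
    (R : Finset (QuantumDouble.Edge N))
    (hstar : QuantumDouble.StarConnected R) (hplaq : QuantumDouble.PlaquetteConnected R)
    (hR : 2 ≤ R.card) :
    (LinearMap.ker (QuantumDouble.davies S h R) : Set (QuantumDouble.Op N G)) =
        Set.range (QuantumDouble.oneTensor R) ∩
          Set.centralizer
            ({O | ∃ s ∈ QuantumDouble.starsMeeting R, O = QuantumDouble.starOp G s} ∪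
              {O | ∃ p ∈ QuantumDouble.plaqsMeeting R, O = QuantumDouble.plaqOp G p}) ∧
      (LinearMap.ker (QuantumDouble.davies S h R) : Set (QuantumDouble.Op N G)) =
        Set.range (QuantumDouble.oneTensor R) ∩
          Set.centralizer
            ({O | ∃ s ∈ QuantumDouble.starsMeeting R, ∃ χ : G →* Circle,
                O = QuantumDouble.starProj s χ} ∪
              {O | ∃ p ∈ QuantumDouble.plaqsMeeting R, ∃ g : G,
                O = QuantumDouble.plaqProj p g}) := by
  have key := QuantumDouble.mem_ker_davies_iff_commute hadj herg hpos hstar hplaq hR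
  constructor
  · ext O
    rw [SetLike.mem_coe, key, Set.mem_inter_iff, QuantumDouble.mem_range_oneTensor_iff]
    refine and_congr_right fun _ => ?_
    constructor
    · rintro ⟨hs, hp⟩ _ (⟨s, hmem, rfl⟩ | ⟨p, hmem, rfl⟩)
      · exact hs s hmem
      · exact hp p hmem
    · exact fun H => ⟨fun s hs => H _ (Or.inl ⟨s, hs, rfl⟩), fun p hp => H _ (Or.inr ⟨p, hp, rfl⟩)⟩
  · ext O
    rw [SetLike.mem_coe, key, Set.mem_inter_iff, QuantumDouble.mem_range_oneTensor_iff]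
    refine and_congr_right fun hO => ?_
    constructor
    · rintro ⟨hs, hp⟩ _ (⟨s, hmem, χ, rfl⟩ | ⟨p, hmem, g, rfl⟩)
      · obtain ⟨e, he⟩ := (Finset.mem_filter.1 hmem).2
        obtain ⟨h1, h2⟩ := Finset.mem_inter.1 he
        exact QuantumDouble.commute_starProj h1 (hO e h2) (hs s hmem) χ
      · obtain ⟨e, he⟩ := (Finset.mem_filter.1 hmem).2
        obtain ⟨h1, h2⟩ := Finset.mem_inter.1 he
        exact QuantumDouble.commute_plaqProj h1 (hO e h2) (hp p hmem) g
    · refine fun H => ⟨fun s hs => ?_, fun p hp => ?_⟩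
      -- The star operator is the generalized one at the trivial character.
      · rw [← QuantumDouble.starProj_one]
        exact H _ (Or.inl ⟨s, hs, 1, rfl⟩)
      · rw [← QuantumDouble.plaqProj_one]
        exact H _ (Or.inr ⟨p, hp, 1, rfl⟩)
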